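/- Let $\Gamma=(\xi,\eta):\mathbb R\to\mathbb R^2$ be a regular $C^2$ closed curve: $\Gamma$ is $C^2$, $L$-periodic for some $L>0$, and $\Gamma'(t)\neq 0$ for all $t$. Write $\mathcal A(\Gamma)=\frac12\int_0^L(\xi\eta'-\eta\xi')\,dt$ for its algebraic area and $\omega(\Gamma)=\frac1{2\pi}\int_0^L\kappa(t)\,\|\Gamma'(t)\|\,dt$, with $\kappa=\det(\Gamma',\Gamma'')/\|\Gamma'\|^3$, for its rotation index. For $R>0$ let $\theta_R(t,\theta_0)$ be the solution of $$\theta'=\tfrac1R\big(\xi'(t)\sin\theta-\eta'(t)\cos\theta\big),\qquad \theta(0)=\theta_0,$$ let $\rho(R)=\frac{L}{2\pi}\lim_{t\to\infty}\frac{\theta_R(t,\theta_0)-\theta_0}{t}$ be its rotation number (independent of $\theta_0$), and let $\mathcal M_R:S^1\to S^1$, $e^{i\theta_0}\mapsto e^{i\theta_R(L,\theta_0)}$, be the monodromy map. The elliptic set of $\Gamma$ is the set of all $R>0$ for which $\mathcal M_R$ is elliptic, i.e. has no fixed point on $S^1$. If $\omega(\Gamma)\ne0$, the critical B-length is $$\underline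 R(\Gamma)=\sup\{R_*>0:\ \rho(R)=\omega(\Gamma)\ \text{for all}\ R\in(0,R_*]\},$$ and the turning B-length is $$\overline R(\Gamma)=\inf\{R^*\ge\underline R(\Gamma):\ \rho(R)\ne\omega(\Gamma)\ \text{for all}\ R>R^*,\ \text{and}\ \rho\ \text{is strictly monotone on}\ (R^*,\infty)\}.$$ Suppose that $\Gamma$ is star-shaped, i.e. there is a point $z_0$ such that every ray originating from $z_0$ meets the curve in exactly one point, and that $\omega(\Gamma)=1$. Then $\rho$, $\underline R(\Gamma)$ and $\overline R(\Gamma)$ are well defined, $\underline R(\Gamma)>0$, the elliptic set of $\Gamma$ is non-empty and connected (it has exactly one connected component), namely it is $(\underline R(\Gamma),\infty)$, and there $\rho$ is differentiable with $$\rho'(R)\le-\frac{\mathcal A(\Gamma)}{\pi R^3},\qquad R>\underline R(\Gamma).$$ In particular, $\underline R(\Gamma)=\overline R(\Gamma)$. -/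

import Mathlib

open Set Filter Topology

noncomputable section

namespace Bicycle

/-- The determinant of the plane vectors `z` and `w`; the plane is identified with `ℂ`. -/
def det (z w : ℂ) : ℝ := z.re * w.im - z.im * w.re

/-- The signed curvature `det (Γ', Γ'') / ‖Γ'‖ ^ 3` of a plane curve. -/
def curvature (Γ : ℝ → ℂ) (t : ℝ) : ℝ :=
  det (deriv Γ t) (deriv (deriv Γ) t) / ‖deriv Γ t‖ ^ 3

/-- The rotation index of a regular closed curve with period `L`: the total signed curvature,
that is, the total variation of the angle of the tangent vector over one period, divided
by `2 π`. -/
def rotationIndex (Γ : ℝ → ℂ) (L : ℝ) : ℝ :=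
  (1 / (2 * Real.pi)) * ∫ t in (0 : ℝ)..L, curvature Γ t * ‖deriv Γ t‖

/-- The algebraic area `(1 / 2) ∮ (x dy - y dx)` enclosed by a closed curve with period `L`. -/
def area (Γ : ℝ → ℂ) (L : ℝ) : ℝ :=
  (1 / 2) * ∫ t in (0 : ℝ)..L, det (Γ t) (deriv Γ t)

/-- A curve (as a subset of the plane) is star-shaped if for some point `z₀` every ray that
originates from `z₀` meets the curve in exactly one point. -/
def IsStarShaped (C : Set ℂ) : Prop :=
  ∃ z₀ : ℂ, ∀ u : ℂ, ‖u‖ = 1 → ∃! p : ℂ, p ∈ C ∧ ∃ r : ℝ, 0 ≤ r ∧ p = z₀ + (r : ℂ) * u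

/-- `θ` solves the bicycle equation `θ' = (ξ' sin θ - η' cos θ) / R` for the front track
`Γ = ξ + i η` and the bicycle length `R`; the rear track is then `Γ + R exp (i θ)`. -/
def IsBicycleAngle (Γ : ℝ → ℂ) (R : ℝ) (θ : ℝ → ℝ) : Prop :=
  ∀ t : ℝ, HasDerivAt θ
    ((1 / R) * ((deriv Γ t).re * Real.sin (θ t) - (deriv Γ t).im * Real.cos (θ t))) t

/-- The solution `t ↦ θ_R (t, θ₀)` of the bicycle equation with `θ 0 = θ₀`. -/
def angleFlow (Γ : ℝ → ℂ) (R θ₀ : ℝ) : ℝ → ℝ :=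
  Classical.epsilon fun θ : ℝ → ℝ => IsBicycleAngle Γ R θ ∧ θ 0 = θ₀

/-- The bicycle equation is globally solvable for every initial angle, and all its solutions have
the rotation number `ρ`, namely `(L / (2 π)) lim (θ t - θ 0) / t = ρ` as `t → ∞`. -/
def HasRotationNumber (Γ : ℝ → ℂ) (L R ρ : ℝ) : Prop :=
  (∀ θ₀ : ℝ, ∃ θ : ℝ → ℝ, IsBicycleAngle Γ R θ ∧ θ 0 = θ₀) ∧
  ∀ θ : ℝ → ℝ, IsBicycleAngle Γ R θ →
    Tendsto (fun t : ℝ => L / (2 * Real.pi) * ((θ t - θ 0) / t)) atTop (𝓝 ρ)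

/-- The rotation number function `R ↦ ρ_Γ (R)` of a closed curve with period `L`. -/
def rotationNumber (Γ : ℝ → ℂ) (L R : ℝ) : ℝ :=
  limUnder atTop fun t : ℝ =>
    L / (2 * Real.pi) * ((angleFlow Γ R 0 t - angleFlow Γ R 0 0) / t)

/-- The monodromy map of the unit circle, `exp (i θ₀) ↦ exp (i θ_R (L, θ₀))`. -/
def monodromy (Γ : ℝ → ℂ) (L R : ℝ) (z : Circle) : Circle :=
  Circle.exp (angleFlow Γ R (Complex.arg (z : ℂ)) L)

/-- The elliptic set: the bicycle lengths for which the monodromy map is elliptic, that is, has no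
fixed point on the unit circle. -/
def ellipticSet (Γ : ℝ → ℂ) (L : ℝ) : Set ℝ :=
  {R : ℝ | 0 < R ∧ ∀ z : Circle, monodromy Γ L R z ≠ z}

/-- The lengths `R' > 0` for which the rotation number equals the rotation index on `(0, R']`. -/
def plateauSet (Γ : ℝ → ℂ) (L : ℝ) : Set ℝ :=
  {R' : ℝ | 0 < R' ∧ ∀ R : ℝ, 0 < R → R ≤ R' → rotationNumber Γ L R = rotationIndex Γ L}

/-- The critical B-length, the right end of the first plateau. -/
def criticalLength (Γ : ℝ → ℂ) (L : ℝ) : ℝ := sSup (plateauSet Γ L)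

/-- The lengths `R'`, not below the critical B-length, for which the rotation number differs from
the rotation index on `(R', ∞)` and is strictly monotone there. -/
def turningSet (Γ : ℝ → ℂ) (L : ℝ) : Set ℝ :=
  {R' : ℝ | criticalLength Γ L ≤ R' ∧
    (∀ R : ℝ, R' < R → rotationNumber Γ L R ≠ rotationIndex Γ L) ∧
    (StrictMonoOn (rotationNumber Γ L) (Ioi R') ∨ StrictAntiOn (rotationNumber Γ L) (Ioi R'))}

/-- The turning B-length. -/
def turningLength (Γ : ℝ → ℂ) (L : ℝ) : ℝ := sInf (turningSet Γ L)

end Bicycle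

end

/-!
# Rotation numbers of bicycle monodromies over star-shaped front tracks

Write `s = 1 / R`, let `g = Γ'` be the velocity of the front wheel and `r s` (`turning`) the
rotation number, extended to `s = 0`, where it vanishes because the frame does not turn. It is the
translation number of the lifted monodromy, hence continuous in `s`, and it is an integer exactly
when the monodromy has a fixed point (`continuous_turning`, `turning_eq_int_iff`).

The rate of change. A solution `θ` of the bicycle equation is twice the argument of a solution of a
linear system whose fundamental matrix `[α, β; conj β, conj α]` lies in `SU(1, 1)`. In the elliptic
case the eigenvector inside the unit disk shows that half the trace of the monodromy matrix is
`cos (π r)` (`cos_turning_of_elliptic`). Duhamel's formula gives the derivative of this trace in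
`s`. With `[i m, n; conj n, -i m]` the trace-free part of the monodromy matrix, transported along
the flow, one has `n' = i s m g`, and an integration by parts turns the derivative of the trace
into `-s ∫ m det (Γ, Γ')`. The determinant of the trace-free part is conserved,
`m ^ 2 - |n| ^ 2 = sin (π r) ^ 2`, so that

  `r' s = s / (2 π) * ∫ w * det (Γ, Γ')` with `w = m / sin (π r) ≥ 1`

wherever `r s` is not an integer (`exists_hasDerivAt_turning`). For a star-shaped curve the areal
velocity `det (Γ, Γ')` about the centre has a constant sign. If it is nonnegative, this
formula gives `r' s ≥ s A / π`, which is the claimed inequality in the variable `R = 1 / s`.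

The global picture. For large `s` the rear wheel trails the front wheel and `r s` is the rotation
index (`exists_turning_eq_of_lt`), here `1`. A continuous function whose derivative is positive at
all its non-integer values is monotone. Therefore `r` climbs from `0` to `1`; the opposite sign of
the areal velocity is impossible, since `r` would then decrease from `0` to `1`
(`exists_center_of_isStarShaped`). Finally `r` cannot rest at `0`, because a
periodic solution for small `s` forces the area to be `O(s)` (`exists_abs_integral_det_le`). So
`0 < r < 1`, and the monodromy is elliptic, up to the point `s₀` where `r` reaches the plateau
`r = 1` (`exists_plateau`); both lengths of the theorem are `1 / s₀`.
-/

namespace Bicycle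

open scoped ComplexConjugate

variable {Γ g α β : ℝ → ℂ} {L s : ℝ} {C : NNReal}

/-! ### Ordinary differential equations with bounded Lipschitz right-hand side -/

/-- An ordinary differential equation with a bounded vector field that is globally Lipschitz in
space has global solutions. -/
theorem exists_isIntegralCurve_of_bounded {E : Type*} [NormedAddCommGroup E] [NormedSpace ℝ E]
    [CompleteSpace E] {F : ℝ → E → E} {K C : NNReal} (hK : ∀ t, LipschitzWith K (F t))
    (hcont : ∀ x, Continuous fun t => F t x) (hC : ∀ t x, ‖F t x‖ ≤ C) (x₀ : E) :
    ∃ y : ℝ → E, IsIntegralCurve y F ∧ y 0 = x₀ := by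
  have local_sol : ∀ n : ℕ, ∃ y : ℝ → E, y 0 = x₀ ∧
      ∀ t ∈ Ioo (-((n : ℝ) + 1)) (n + 1), HasDerivAt y (F t (y t)) t := by
    intro n
    have hn : (0 : ℝ) ≤ n := n.cast_nonneg
    have h0 : (0 : ℝ) ∈ Icc (-((n : ℝ) + 1)) (n + 1) := ⟨by linarith, by linarith⟩
    have hPL : IsPicardLindelof F (⟨0, h0⟩ : Icc (-((n : ℝ) + 1)) (n + 1)) x₀
        (C * (n + 1)) 0 C K :=
      { lipschitzOnWith := fun t _ => (hK t).lipschitzOnWith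
        continuousOn := fun x _ => (hcont x).continuousOn
        norm_le := fun t _ x _ => hC t x
        mul_max_le := by simp }
    obtain ⟨y, hy0, hy⟩ := hPL.exists_eq_forall_mem_Icc_hasDerivWithinAt₀
    exact ⟨y, hy0, fun t ht => (hy t (Ioo_subset_Icc_self ht)).hasDerivAt
      (Icc_mem_nhds ht.1 ht.2)⟩
  choose y hy0 hy using local_sol
  have agree : ∀ m n : ℕ, ∀ t : ℝ, |t| < m + 1 → |t| < n + 1 → y m t = y n t := by
    intro m n t hm hn
    have hsub : ∀ k : ℕ, min (m : ℝ) n ≤ k → Ioo (-(min (m : ℝ) n + 1)) (min (m : ℝ) n + 1) ⊆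
        Ioo (-((k : ℝ) + 1)) (k + 1) := fun k hk =>
      Ioo_subset_Ioo (by linarith) (by linarith)
    have h0 : (0 : ℝ) ≤ min (m : ℝ) n := le_min m.cast_nonneg n.cast_nonneg
    refine ODE_solution_unique_of_mem_Ioo (v := F) (s := fun _ => univ) (t₀ := 0) (K := K)
      (a := -(min (m : ℝ) n + 1)) (b := min (m : ℝ) n + 1)
      (fun t _ => (hK t).lipschitzOnWith) ⟨by linarith, by linarith⟩
      (fun t ht => ⟨hy m t (hsub m (min_le_left _ _) ht), mem_univ _⟩)
      (fun t ht => ⟨hy n t (hsub n (min_le_right _ _) ht), mem_univ _⟩)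
      ((hy0 m).trans (hy0 n).symm) ?_
    rw [mem_Ioo, ← abs_lt]
    rcases min_choice (m : ℝ) n with h | h <;> rw [h] <;> assumption
  refine ⟨fun t => y ⌈|t|⌉₊ t, fun t => ?_, hy0 _⟩
  have ht : |t| < ⌈|t|⌉₊ + 1 := by linarith [Nat.le_ceil |t|]
  refine (hy ⌈|t|⌉₊ t (abs_lt.mp ht)).congr_of_eventuallyEq ?_
  filter_upwards [(isOpen_lt continuous_abs continuous_const).mem_nhds ht] with u hu
  exact agree _ _ _ (by linarith [Nat.le_ceil |u|]) hu

/-- Solutions of `y' = s • F t y` with a fixed initial value depend on the parameter `s` in a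
Lipschitz way near `s₀`, uniformly on a compact time interval. -/
theorem exists_dist_le_mul_of_isIntegralCurve_smul {E : Type*} [NormedAddCommGroup E]
    [NormedSpace ℝ E] {F : ℝ → E → E} {K : NNReal} (hK : ∀ t, LipschitzWith K (F t))
    {y : ℝ → ℝ → E} (hy : ∀ s, IsIntegralCurve (y s) fun t x => s • F t x) {y₀ : E}
    (h0 : ∀ s, y s 0 = y₀) {s₀ M T : ℝ} (hM : ∀ t ∈ Icc 0 T, ‖F t (y s₀ t)‖ ≤ M) (hT : 0 ≤ T) :
    ∃ B : ℝ, ∀ s, |s - s₀| ≤ 1 → ∀ t ∈ Icc 0 T, dist (y s t) (y s₀ t) ≤ B * |s - s₀| := by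
  set K' : NNReal := (‖s₀‖₊ + 1) * K with hK'
  have hM0 : 0 ≤ M := (norm_nonneg _).trans (hM 0 ⟨le_rfl, hT⟩)
  have scale : ∀ ε x : ℝ, gronwallBound 0 K' ε x = gronwallBound 0 K' 1 x * ε := by
    intro ε x
    unfold gronwallBound
    split_ifs <;> ring
  refine ⟨gronwallBound 0 K' 1 T * M, fun s hs t ht => ?_⟩
  have hs' : ‖s‖₊ ≤ ‖s₀‖₊ + 1 := by
    rw [← NNReal.coe_le_coe]
    push_cast
    rw [Real.norm_eq_abs, Real.norm_eq_abs]
    linarith [abs_sub_abs_le_abs_sub s s₀]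
  have hLip : ∀ t, LipschitzWith K' (fun x => s • F t x) := fun t =>
    ((lipschitzWith_smul s).comp (hK t)).weaken (by rw [hK']; gcongr)
  have hc : ∀ s, ContinuousOn (y s) (Icc 0 T) := fun s => (hy s).continuous.continuousOn
  have key := dist_le_of_approx_trajectories_ODE (a := 0) (b := T) (δ := 0) (εf := 0)
    (εg := |s - s₀| * M) hLip (hc s) (fun t _ => (hy s t).hasDerivWithinAt)
    (fun t _ => (dist_self _).le) (hc s₀) (fun t _ => (hy s₀ t).hasDerivWithinAt)
    (fun t ht => ?_) (by rw [h0, h0, dist_self]) t ht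
  · rw [zero_add, sub_zero] at key
    refine key.trans ?_
    rw [scale]
    have := gronwallBound_mono le_rfl zero_le_one K'.coe_nonneg ht.2
    calc _ ≤ gronwallBound 0 K' 1 T * (|s - s₀| * M) := by gcongr
      _ = _ := by ring
  · rw [dist_eq_norm, ← sub_smul, norm_smul, Real.norm_eq_abs, abs_sub_comm]
    exact mul_le_mul_of_nonneg_left (hM t (Ico_subset_Icc_self ht)) (abs_nonneg _)

/-! ### The angle equation -/

/-- The angular velocity `Im (conj (g t) * exp (i θ))`: the field of the bicycle equation for a
front wheel with velocity `g` and a bicycle of unit length. -/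
noncomputable def angularField (g : ℝ → ℂ) (t θ : ℝ) : ℝ :=
  (g t).re * Real.sin θ - (g t).im * Real.cos θ

/-- `θ` solves the bicycle equation of a front wheel with velocity `g`, where `s` is the inverse
of the bicycle length; the value `s = 0` is allowed. -/
def IsAngle (g : ℝ → ℂ) (s : ℝ) (θ : ℝ → ℝ) : Prop :=
  IsIntegralCurve θ fun t x => s • angularField g t x

theorem isBicycleAngle_iff {Γ : ℝ → ℂ} {R : ℝ} {θ : ℝ → ℝ} :
    IsBicycleAngle Γ R θ ↔ IsAngle (deriv Γ) R⁻¹ θ := by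
  simp [IsBicycleAngle, IsAngle, IsIntegralCurve, angularField]

theorem lipschitzWith_angularField {g : ℝ → ℂ} {C : NNReal} (hC : ∀ t, ‖g t‖ ≤ C) (t : ℝ) :
    LipschitzWith (2 * C) (angularField g t) := by
  refine LipschitzWith.of_dist_le_mul fun x y => ?_
  have h1 : |Real.sin x - Real.sin y| ≤ |x - y| := by
    simpa [Real.dist_eq] using Real.lipschitzWith_sin.dist_le_mul x y
  have h2 : |Real.cos x - Real.cos y| ≤ |x - y| := by
    simpa [Real.dist_eq] using Real.lipschitzWith_cos.dist_le_mul x y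
  have e : angularField g t x - angularField g t y = (g t).re * (Real.sin x - Real.sin y) -
      (g t).im * (Real.cos x - Real.cos y) := by unfold angularField; ring
  rw [Real.dist_eq, Real.dist_eq, e]
  refine (abs_sub _ _).trans ?_
  rw [abs_mul, abs_mul]
  have h3 := (Complex.abs_re_le_norm (g t)).trans (hC t)
  have h4 := (Complex.abs_im_le_norm (g t)).trans (hC t)
  calc _ ≤ (C : ℝ) * |x - y| + C * |x - y| := by gcongr
    _ = _ := by push_cast; ring

theorem angularField_eq_im (g : ℝ → ℂ) (t θ : ℝ) :
    angularField g t θ = (starRingEnd ℂ (g t) * Complex.exp (θ * Complex.I)).im := by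
  simp only [angularField, Complex.mul_im, Complex.conj_re, Complex.conj_im,
    Complex.exp_ofReal_mul_I_re, Complex.exp_ofReal_mul_I_im]
  ring

theorem abs_angularField_le (g : ℝ → ℂ) (t θ : ℝ) : |angularField g t θ| ≤ ‖g t‖ := by
  rw [angularField_eq_im]
  refine (Complex.abs_im_le_norm _).trans ?_
  simp [Complex.norm_exp_ofReal_mul_I]

theorem exists_isAngle (hg : Continuous g) (hC : ∀ t, ‖g t‖ ≤ C) (s θ₀ : ℝ) :
    ∃ θ, IsAngle g s θ ∧ θ 0 = θ₀ := by
  refine exists_isIntegralCurve_of_bounded (K := ‖s‖₊ * (2 * C)) (C := ‖s‖₊ * C)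
    (fun t => (lipschitzWith_smul s).comp (lipschitzWith_angularField hC t)) (fun x => ?_)
    (fun t x => ?_) θ₀
  · unfold angularField
    fun_prop
  · rw [Function.comp_apply, norm_smul]
    push_cast
    gcongr
    exact (abs_angularField_le g t x).trans (hC t)

theorem IsAngle.eq_of_eq (hC : ∀ t, ‖g t‖ ≤ C) {θ₁ θ₂ : ℝ → ℝ} (h₁ : IsAngle g s θ₁)
    (h₂ : IsAngle g s θ₂) {t : ℝ} (h : θ₁ t = θ₂ t) : θ₁ = θ₂ :=
  ODE_solution_unique_univ (K := ‖s‖₊ * (2 * C)) (s := fun _ => univ)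
    (fun t => ((lipschitzWith_smul s).comp (lipschitzWith_angularField hC t)).lipschitzOnWith)
    (fun t => ⟨h₁ t, mem_univ _⟩) (fun t => ⟨h₂ t, mem_univ _⟩) h

theorem IsAngle.add_int_mul_two_pi {θ : ℝ → ℝ} (h : IsAngle g s θ) (n : ℤ) :
    IsAngle g s fun t => θ t + n * (2 * Real.pi) := fun t => by
  have := (h t).add_const (n * (2 * Real.pi))
  simpa [angularField, Real.sin_add_int_mul_two_pi, Real.cos_add_int_mul_two_pi] using this

theorem IsAngle.comp_add_period (hp : Function.Periodic g L) {θ : ℝ → ℝ} (h : IsAngle g s θ) :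
    IsAngle g s fun t => θ (t + L) := fun t => by
  have := (h (t + L)).comp_add_const t L
  simpa only [angularField, hp t] using this

theorem IsAngle.comp_sub_period (hp : Function.Periodic g L) {θ : ℝ → ℝ} (h : IsAngle g s θ) :
    IsAngle g s fun t => θ (t - L) := by
  have := h.comp_add_period (L := -L) hp.neg
  simpa only [← sub_eq_add_neg] using this

theorem IsAngle.le_of_le (hC : ∀ t, ‖g t‖ ≤ C) {θ₁ θ₂ : ℝ → ℝ} (h₁ : IsAngle g s θ₁)
    (h₂ : IsAngle g s θ₂) (h : θ₁ 0 ≤ θ₂ 0) (t : ℝ) : θ₁ t ≤ θ₂ t := by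
  by_contra! hlt
  obtain ⟨u, hu⟩ : ∃ u, (θ₂ - θ₁) u = 0 :=
    mem_range_of_exists_le_of_exists_ge (h₂.continuous.sub h₁.continuous)
      ⟨t, by simpa using hlt.le⟩ ⟨0, by simpa using h⟩
  have := h₁.eq_of_eq hC h₂ (t := u) (by simpa [sub_eq_zero, eq_comm] using hu)
  exact hlt.ne' (congrFun this t)

/-! ### The rotation number as a translation number -/

/-- The velocity of a closed front track with period `L`. -/
structure IsPeriodicVelocity (g : ℝ → ℂ) (L : ℝ) : Prop where
  continuous : Continuous g
  periodic : Function.Periodic g L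
  pos : 0 < L

theorem exists_norm_le_of_periodic {f : ℝ → ℂ} (hf : Continuous f) (hp : Function.Periodic f L)
    (hL : 0 < L) : ∃ C : NNReal, ∀ t, ‖f t‖ ≤ C := by
  obtain ⟨C, hC⟩ := isCompact_Icc.exists_bound_of_continuousOn (s := Icc 0 L) hf.continuousOn
  refine ⟨C.toNNReal, fun t => ?_⟩
  obtain ⟨u, hu, hut⟩ := hp.exists_mem_Ico₀ hL t
  rw [hut]
  exact (hC u (Ico_subset_Icc_self hu)).trans (Real.le_coe_toNNReal C)

theorem IsPeriodicVelocity.exists_norm_le (hV : IsPeriodicVelocity g L) :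
    ∃ C : NNReal, ∀ t, ‖g t‖ ≤ C :=
  exists_norm_le_of_periodic hV.continuous hV.periodic hV.pos

/-- The solution of the bicycle equation with initial angle `θ₀`. -/
noncomputable def angle (g : ℝ → ℂ) (s θ₀ : ℝ) : ℝ → ℝ :=
  Classical.epsilon fun θ : ℝ → ℝ => IsAngle g s θ ∧ θ 0 = θ₀

theorem IsPeriodicVelocity.angle_spec (hV : IsPeriodicVelocity g L) (s θ₀ : ℝ) :
    IsAngle g s (angle g s θ₀) ∧ angle g s θ₀ 0 = θ₀ :=
  let ⟨_, hC⟩ := hV.exists_norm_le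
  Classical.epsilon_spec (p := fun θ : ℝ → ℝ => IsAngle g s θ ∧ θ 0 = θ₀)
    (exists_isAngle hV.continuous hC s θ₀)

theorem IsAngle.angle_eq (hV : IsPeriodicVelocity g L) {θ : ℝ → ℝ} (h : IsAngle g s θ) :
    angle g s (θ 0) = θ :=
  let ⟨_, hC⟩ := hV.exists_norm_le
  (hV.angle_spec s (θ 0)).1.eq_of_eq hC h (t := 0) (hV.angle_spec s (θ 0)).2

/-- The lift of the monodromy map to the real line, in units of full turns. -/
noncomputable def monodromyLift (hV : IsPeriodicVelocity g L) (s : ℝ) : CircleDeg1Lift where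
  toFun x := angle g s (2 * Real.pi * x) L / (2 * Real.pi)
  monotone' x y hxy := by
    obtain ⟨C, hC⟩ := hV.exists_norm_le
    dsimp only
    gcongr
    refine (hV.angle_spec s _).1.le_of_le hC (hV.angle_spec s _).1 ?_ L
    rw [(hV.angle_spec s _).2, (hV.angle_spec s _).2]
    gcongr
  map_add_one' x := by
    have h := ((hV.angle_spec s (2 * Real.pi * x)).1.add_int_mul_two_pi 1).angle_eq hV
    rw [(hV.angle_spec s _).2] at h
    have e : 2 * Real.pi * (x + 1) = 2 * Real.pi * x + (1 : ℤ) * (2 * Real.pi) := by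
      push_cast
      ring
    rw [e, h]
    have := Real.pi_pos
    field_simp
    push_cast
    ring

theorem IsAngle.monodromyLift_apply (hV : IsPeriodicVelocity g L) {θ : ℝ → ℝ}
    (h : IsAngle g s θ) : monodromyLift hV s (θ 0 / (2 * Real.pi)) = θ L / (2 * Real.pi) := by
  change angle g s (2 * Real.pi * (θ 0 / (2 * Real.pi))) L / (2 * Real.pi) = _
  rw [mul_div_cancel₀ _ Real.two_pi_pos.ne', h.angle_eq hV]

theorem IsAngle.monodromyLift_pow_apply (hV : IsPeriodicVelocity g L) {θ : ℝ → ℝ}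
    (h : IsAngle g s θ) (n : ℕ) :
    (monodromyLift hV s ^ n) (θ 0 / (2 * Real.pi)) = θ (n * L) / (2 * Real.pi) := by
  induction n with
  | zero => simp
  | succ n ih =>
    have := (h.comp_add_period (hV.periodic.nat_mul n)).monodromyLift_apply hV
    rw [pow_succ', CircleDeg1Lift.mul_apply, ih]
    rw [zero_add] at this
    rw [this]
    push_cast
    ring_nf

theorem continuous_monodromyLift (hV : IsPeriodicVelocity g L) (s : ℝ) :
    Continuous (monodromyLift hV s) := by
  refine (monodromyLift hV s).monotone.continuous_of_surjective fun y => ?_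
  obtain ⟨h, h0⟩ := hV.angle_spec s (2 * Real.pi * y)
  have := (h.comp_sub_period hV.periodic).monodromyLift_apply hV
  rw [sub_self, h0, mul_div_cancel_left₀ _ Real.two_pi_pos.ne'] at this
  exact ⟨_, this⟩

/-- The rotation number of the bicycle equation, as a function of the inverse `s` of the bicycle
length. -/
noncomputable def turning (hV : IsPeriodicVelocity g L) (s : ℝ) : ℝ :=
  CircleDeg1Lift.translationNumber (monodromyLift hV s)

theorem abs_map_sub_sub_translationNumber_le (f : CircleDeg1Lift) (x : ℝ) :
    |f x - x - f.translationNumber| ≤ 1 := by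
  have h1 := f.map_lt_add_translationNumber_add_one x
  have h2 : x + ((⌈f.translationNumber⌉ - 1 : ℤ) : ℝ) < f x := by
    refine f.lt_map_of_int_lt_translationNumber ?_ x
    push_cast
    linarith [Int.ceil_lt_add_one f.translationNumber]
  push_cast at h2
  have h3 := Int.le_ceil f.translationNumber
  rw [abs_le]
  constructor <;> linarith

theorem IsAngle.abs_sub_sub_le (hV : IsPeriodicVelocity g L) {θ : ℝ → ℝ} (h : IsAngle g s θ)
    (n : ℕ) : |θ (n * L) - θ 0 - n * (2 * Real.pi * turning hV s)| ≤ 2 * Real.pi := by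
  have key := abs_map_sub_sub_translationNumber_le (monodromyLift hV s ^ n) (θ 0 / (2 * Real.pi))
  rw [h.monodromyLift_pow_apply hV, CircleDeg1Lift.translationNumber_pow] at key
  have e : θ (n * L) - θ 0 - n * (2 * Real.pi * turning hV s) = 2 * Real.pi *
      (θ (n * L) / (2 * Real.pi) - θ 0 / (2 * Real.pi) -
        n * CircleDeg1Lift.translationNumber (monodromyLift hV s)) := by
    have := Real.pi_pos
    unfold turning
    field_simp
  rw [e, abs_mul, abs_of_pos Real.two_pi_pos]
  have := mul_le_mul_of_nonneg_left key Real.two_pi_pos.le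
  linarith

/-- A solution that stays close to an arithmetic progression along the multiples of the period
determines the rotation number. -/
theorem IsAngle.turning_eq (hV : IsPeriodicVelocity g L) {θ : ℝ → ℝ} (h : IsAngle g s θ)
    {δ D : ℝ} (hD : ∀ n : ℕ, |θ (n * L) - n * δ| ≤ D) : turning hV s = δ / (2 * Real.pi) := by
  suffices 2 * Real.pi * turning hV s - δ = 0 by
    have := Real.pi_pos
    field_simp
    linarith
  by_contra hne
  have hpos := abs_pos.mpr hne
  obtain ⟨n, hn⟩ := exists_nat_gt ((D + 2 * Real.pi + |θ 0|) / |2 * Real.pi * turning hV s - δ|)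
  rw [div_lt_iff₀ hpos] at hn
  have h1 := h.abs_sub_sub_le hV n
  have h2 := hD n
  have e : (n : ℝ) * (2 * Real.pi * turning hV s - δ) = (θ (n * L) - n * δ) -
      (θ (n * L) - θ 0 - n * (2 * Real.pi * turning hV s)) - θ 0 := by ring
  have h3 : (n : ℝ) * |2 * Real.pi * turning hV s - δ| =
      |(n : ℝ) * (2 * Real.pi * turning hV s - δ)| := by rw [abs_mul, Nat.abs_cast]
  have h4 := abs_sub ((θ (n * L) - n * δ) - (θ (n * L) - θ 0 - n * (2 * Real.pi * turning hV s)))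
    (θ 0)
  have h5 := abs_sub (θ (n * L) - n * δ) (θ (n * L) - θ 0 - n * (2 * Real.pi * turning hV s))
  rw [← e, ← h3] at h4
  linarith

theorem IsAngle.tendsto_turning (hV : IsPeriodicVelocity g L) {θ : ℝ → ℝ} (h : IsAngle g s θ) :
    Tendsto (fun t => L / (2 * Real.pi) * ((θ t - θ 0) / t)) atTop (𝓝 (turning hV s)) := by
  obtain ⟨C, hC⟩ := hV.exists_norm_le
  have hL := hV.pos
  have hLip : ∀ t u, |θ t - θ u| ≤ |s| * C * |t - u| := fun t u => by
    have := Convex.norm_image_sub_le_of_norm_hasDerivWithin_le (C := |s| * C) (s := univ)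
      (fun x _ => (h x).hasDerivWithinAt) (fun x _ => by
        rw [norm_smul, Real.norm_eq_abs]
        gcongr
        exact (abs_angularField_le g x _).trans (hC x)) convex_univ (mem_univ u) (mem_univ t)
    simpa using this
  set ρ := turning hV s
  set D := 2 * Real.pi + |s| * C * L + |2 * Real.pi * ρ|
  have bound : ∀ t, 0 < t → |θ t - θ 0 - t / L * (2 * Real.pi * ρ)| ≤ D := by
    intro t ht
    set n := ⌊t / L⌋₊
    have hn1 : (n : ℝ) ≤ t / L := Nat.floor_le (by positivity)
    have hn2 : t / L < n + 1 := Nat.lt_floor_add_one _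
    have h1 := h.abs_sub_sub_le hV n
    have hr : |t - n * L| ≤ L := by
      rw [le_div_iff₀ hL] at hn1
      rw [div_lt_iff₀ hL] at hn2
      rw [abs_le]
      constructor <;> linarith
    have h2 : |θ t - θ (n * L)| ≤ |s| * C * L := (hLip _ _).trans (by gcongr)
    have h3 : |(t / L - n) * (2 * Real.pi * ρ)| ≤ |2 * Real.pi * ρ| := by
      rw [abs_mul]
      refine mul_le_of_le_one_left (abs_nonneg _) ?_
      rw [abs_le]
      constructor <;> linarith
    have e : θ t - θ 0 - t / L * (2 * Real.pi * ρ) =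
        (θ (n * L) - θ 0 - n * (2 * Real.pi * ρ)) + (θ t - θ (n * L)) -
          (t / L - n) * (2 * Real.pi * ρ) := by ring
    rw [e]
    refine (abs_sub _ _).trans ?_
    refine (add_le_add_left (abs_add_le _ _) _).trans ?_
    exact add_le_add (add_le_add h1 h2) h3
  have hlim : Tendsto (fun t : ℝ => L / (2 * Real.pi) * (D / t)) atTop (𝓝 0) := by
    simpa using (tendsto_const_nhds.div_atTop tendsto_id).const_mul (L / (2 * Real.pi))
  rw [tendsto_iff_dist_tendsto_zero]
  refine squeeze_zero' (Eventually.of_forall fun _ => dist_nonneg) ?_ hlim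
  filter_upwards [eventually_gt_atTop 0] with t ht
  have hpi := Real.pi_pos
  have e : L / (2 * Real.pi) * ((θ t - θ 0) / t) - ρ =
      L / (2 * Real.pi) * ((θ t - θ 0 - t / L * (2 * Real.pi * ρ)) / t) := by
    field_simp
  rw [Real.dist_eq, e, abs_mul, abs_of_pos (show 0 < L / (2 * Real.pi) by positivity), abs_div,
    abs_of_pos ht]
  have := bound t ht
  gcongr

theorem turning_zero (hV : IsPeriodicVelocity g L) : turning hV 0 = 0 := by
  have h : IsAngle g 0 fun _ => 0 := fun t => by simpa using hasDerivAt_const t (0 : ℝ)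
  simpa using h.turning_eq hV (δ := 0) (D := 0) (by simp)

/-- The rotation number depends continuously on the inverse length: it is the uniform limit of the
average rotation over `n` periods. -/
theorem continuous_turning (hV : IsPeriodicVelocity g L) : Continuous (turning hV) := by
  obtain ⟨C, hC⟩ := hV.exists_norm_le
  have hsol : ∀ T : ℝ, 0 ≤ T → Continuous fun s => angle g s 0 T := by
    intro T hT
    rw [continuous_iff_continuousAt]
    intro s₀
    obtain ⟨B, hB⟩ := exists_dist_le_mul_of_isIntegralCurve_smul (lipschitzWith_angularField hC)
      (y := fun s => angle g s 0) (fun s => (hV.angle_spec s 0).1) (fun s => (hV.angle_spec s 0).2)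
      (s₀ := s₀) (fun t _ => (abs_angularField_le g t _).trans (hC t)) hT
    rw [ContinuousAt, tendsto_iff_dist_tendsto_zero]
    have hlim : Tendsto (fun s => B * |s - s₀|) (𝓝 s₀) (𝓝 0) := by
      have : Continuous fun s => B * |s - s₀| := by fun_prop
      simpa using this.tendsto s₀
    refine squeeze_zero' (Eventually.of_forall fun _ => dist_nonneg) ?_ hlim
    filter_upwards [Metric.closedBall_mem_nhds s₀ one_pos] with s hs
    exact hB s (by simpa [Real.dist_eq] using hs) T ⟨hT, le_rfl⟩
  refine continuous_of_uniform_approx_of_continuous fun u hu => ?_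
  obtain ⟨ε, hε, hεu⟩ := Metric.mem_uniformity_dist.mp hu
  obtain ⟨n, hn⟩ := exists_nat_gt (1 / ε)
  have hn0 : (0 : ℝ) < n := (by positivity : 0 < 1 / ε).trans hn
  refine ⟨fun s => angle g s 0 (n * L) / (2 * Real.pi * n),
    (hsol _ (mul_nonneg n.cast_nonneg hV.pos.le)).div_const _, fun s => hεu ?_⟩
  obtain ⟨h, h0⟩ := hV.angle_spec s 0
  have key := h.abs_sub_sub_le hV n
  rw [h0, sub_zero] at key
  have hpi := Real.pi_pos
  have e : turning hV s - angle g s 0 (n * L) / (2 * Real.pi * n) =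
      -((angle g s 0 (n * L) - n * (2 * Real.pi * turning hV s)) / (2 * Real.pi * n)) := by
    field_simp
    ring
  rw [Real.dist_eq, e, abs_neg, abs_div, abs_of_pos (by positivity : 0 < 2 * Real.pi * (n : ℝ)),
    div_lt_iff₀ (by positivity)]
  rw [div_lt_iff₀ hε] at hn
  nlinarith

/-- The rotation number is the integer `m` iff some solution gains exactly `m` turns in one
period. -/
theorem turning_eq_int_iff (hV : IsPeriodicVelocity g L) {m : ℤ} :
    turning hV s = m ↔ ∃ θ, IsAngle g s θ ∧ θ L = θ 0 + m * (2 * Real.pi) := by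
  rw [turning, CircleDeg1Lift.translationNumber_eq_int_iff _ (continuous_monodromyLift hV s)]
  have hpi := Real.two_pi_pos.ne'
  constructor
  · rintro ⟨x, hx⟩
    obtain ⟨h, h0⟩ := hV.angle_spec s (2 * Real.pi * x)
    refine ⟨_, h, ?_⟩
    have := h.monodromyLift_apply hV
    rw [h0, mul_div_cancel_left₀ _ hpi, hx, eq_div_iff hpi] at this
    rw [h0]
    linarith
  · rintro ⟨θ, h, hθ⟩
    refine ⟨θ 0 / (2 * Real.pi), ?_⟩
    rw [h.monodromyLift_apply hV, hθ]
    field_simp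

/-! ### The linear system behind the bicycle equation -/

theorem eq_of_hasDerivAt_zero {f : ℝ → ℂ} (h : ∀ t, HasDerivAt f 0 t) (t u : ℝ) : f t = f u :=
  is_const_of_deriv_eq_zero (fun t => (h t).differentiableAt) (fun t => (h t).deriv) t u

theorem hasDerivAt_conj {f : ℝ → ℂ} {f' : ℂ} {t : ℝ} (h : HasDerivAt f f' t) :
    HasDerivAt (fun t => conj (f t)) (conj f') t := h.star

theorem conj_exp_half (x : ℝ) :
    conj (Complex.exp (x / 2 * Complex.I)) = Complex.exp (-(x / 2 * Complex.I)) := by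
  rw [← Complex.exp_conj]
  simp [map_ofNat]

/-- A nowhere vanishing `C¹` function is the exponential of the integral of its logarithmic
derivative. -/
theorem eq_mul_exp_integral {f f' : ℝ → ℂ} (hf : ∀ t, HasDerivAt f (f' t) t)
    (hf' : Continuous f') (h0 : ∀ t, f t ≠ 0) (t : ℝ) :
    f t = f 0 * Complex.exp (∫ u in (0 : ℝ)..t, f' u / f u) := by
  have hfc : Continuous f := continuous_iff_continuousAt.mpr fun t => (hf t).continuousAt
  have hc : Continuous fun u => f' u / f u := hf'.div hfc h0
  have hE : ∀ t, HasDerivAt (fun t => ∫ u in (0 : ℝ)..t, f' u / f u) (f' t / f t) t := fun t =>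
    intervalIntegral.integral_hasDerivAt_right (hc.intervalIntegrable _ _)
      hc.aestronglyMeasurable.stronglyMeasurableAtFilter hc.continuousAt
  have key := eq_of_hasDerivAt_zero
    (f := fun t => f t * Complex.exp (-∫ u in (0 : ℝ)..t, f' u / f u)) (fun t => by
      refine ((hf t).mul (hE t).neg.cexp).congr_deriv ?_
      have := h0 t
      field_simp
      ring) t 0
  simp only [intervalIntegral.integral_same, neg_zero, Complex.exp_zero, mul_one,
    Complex.exp_neg] at key
  rw [← key, mul_assoc, inv_mul_cancel₀ (Complex.exp_ne_zero _), mul_one]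

/-- The pair `(p, q)` solves the linear system whose quotients `z = p / q` are the solutions of the
Riccati equation `2 z' = s (conj g * z ^ 2 - g)`; on the unit circle `z = exp (i θ)` this is the
bicycle equation. -/
structure IsLinearPair (g : ℝ → ℂ) (s : ℝ) (p q : ℝ → ℂ) : Prop where
  hasDerivAt_fst : ∀ t, HasDerivAt p (-(s / 2) * g t * q t) t
  hasDerivAt_snd : ∀ t, HasDerivAt q (-(s / 2) * conj (g t) * p t) t

/-- `[α, β; conj β, conj α]`, an element of `SU(1, 1)`, is the fundamental matrix of the linear
system; it acts on the unit circle by the flow of the bicycle equation. -/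
structure IsTransfer (g : ℝ → ℂ) (s : ℝ) (α β : ℝ → ℂ) : Prop where
  hasDerivAt_fst : ∀ t, HasDerivAt α (-(s / 2) * g t * conj (β t)) t
  hasDerivAt_snd : ∀ t, HasDerivAt β (-(s / 2) * g t * conj (α t)) t
  fst_zero : α 0 = 1
  snd_zero : β 0 = 0

/-- A solution `θ` of the bicycle equation is twice the argument of a solution `(v, conj v)` of the
linear system. -/
theorem IsAngle.exists_isLinearPair (hg : Continuous g) {θ : ℝ → ℝ} (h : IsAngle g s θ) :
    ∃ l : ℝ → ℝ, (∀ t, 0 < l t) ∧ l 0 = 1 ∧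
      IsLinearPair g s (fun t => l t * Complex.exp (θ t / 2 * Complex.I))
        (fun t => l t * Complex.exp (-(θ t / 2 * Complex.I))) := by
  set k : ℝ → ℂ := fun t => s / 2 * g t * Complex.exp (-(θ t * Complex.I)) with hk
  have hθ := h.continuous
  have hc : Continuous fun t => (k t).re := by
    rw [hk]
    fun_prop
  have hI : ∀ t, HasDerivAt (fun t => ∫ u in (0 : ℝ)..t, (k u).re) (k t).re t := fun t =>
    intervalIntegral.integral_hasDerivAt_right (hc.intervalIntegrable _ _)
      hc.aestronglyMeasurable.stronglyMeasurableAtFilter hc.continuousAt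
  have hl : ∀ t, HasDerivAt (fun t => Real.exp (-∫ u in (0 : ℝ)..t, (k u).re))
      (Real.exp (-∫ u in (0 : ℝ)..t, (k u).re) * -(k t).re) t := fun t => (hI t).neg.exp
  have him : ∀ t, s • angularField g t (θ t) = -2 * (k t).im := fun t => by
    rw [hk]
    simp only [neg_mul_eq_neg_mul, ← Complex.ofReal_neg, Complex.mul_im, Complex.mul_re,
      Complex.exp_ofReal_mul_I_re, Complex.exp_ofReal_mul_I_im, Real.cos_neg, Real.sin_neg,
      angularField, smul_eq_mul]
    norm_num
    ring
  have hθ' : ∀ t, HasDerivAt (fun t => ((θ t : ℝ) : ℂ)) ((-2 * (k t).im : ℝ) : ℂ) t := fun t => by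
    rw [← him]
    exact (h t).ofReal_comp
  have hv : ∀ t, HasDerivAt (fun t => (Real.exp (-∫ u in (0 : ℝ)..t, (k u).re) : ℂ) *
      Complex.exp (θ t / 2 * Complex.I)) (-(s / 2) * g t *
        ((Real.exp (-∫ u in (0 : ℝ)..t, (k u).re) : ℂ) *
          Complex.exp (-(θ t / 2 * Complex.I)))) t := fun t => by
    refine ((hl t).ofReal_comp.mul
      (((hθ' t).div_const 2).mul_const Complex.I).cexp).congr_deriv ?_
    have e1 : Complex.exp (-(θ t / 2 * Complex.I)) =
        Complex.exp (-(θ t * Complex.I)) * Complex.exp (θ t / 2 * Complex.I) := by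
      rw [← Complex.exp_add]
      ring_nf
    have e2 := Complex.re_add_im (k t)
    have e3 : k t = s / 2 * g t * Complex.exp (-(θ t * Complex.I)) := rfl
    rw [e1]
    simp only [Complex.ofReal_mul, Complex.ofReal_neg, Complex.ofReal_ofNat]
    linear_combination (-(Real.exp (-∫ u in (0 : ℝ)..t, (k u).re) : ℂ) *
      Complex.exp (θ t / 2 * Complex.I)) * (e2 + e3)
  refine ⟨fun t => Real.exp (-∫ u in (0 : ℝ)..t, (k u).re), fun t => Real.exp_pos _, by simp,
    hv, fun t => ?_⟩
  have e : ∀ t, conj (Complex.exp (θ t / 2 * Complex.I)) =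
      Complex.exp (-(θ t / 2 * Complex.I)) := fun t => conj_exp_half (θ t)
  have := hasDerivAt_conj (hv t)
  simp only [map_mul, map_neg, map_div₀, Complex.conj_ofReal, e, map_ofNat] at this
  simpa only [← e, Complex.conj_conj] using this

theorem IsTransfer.left (h : IsTransfer g s α β) : IsLinearPair g s α fun t => conj (β t) :=
  ⟨h.hasDerivAt_fst, fun t => by
    have := hasDerivAt_conj (h.hasDerivAt_snd t)
    simpa [map_ofNat] using this⟩

theorem IsTransfer.right (h : IsTransfer g s α β) : IsLinearPair g s β fun t => conj (α t) :=
  ⟨h.hasDerivAt_snd, fun t => by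
    have := hasDerivAt_conj (h.hasDerivAt_fst t)
    simpa [map_ofNat] using this⟩

theorem IsPeriodicVelocity.exists_isTransfer (hV : IsPeriodicVelocity g L) (s : ℝ) :
    ∃ α β, IsTransfer g s α β := by
  obtain ⟨h₀, h₀0⟩ := hV.angle_spec s 0
  obtain ⟨h₁, h₁0⟩ := hV.angle_spec s Real.pi
  obtain ⟨l₀, -, l₀0, hp⟩ := h₀.exists_isLinearPair hV.continuous
  obtain ⟨l₁, -, l₁0, hq⟩ := h₁.exists_isLinearPair hV.continuous
  set v₀ : ℝ → ℂ := fun t => l₀ t * Complex.exp (angle g s 0 t / 2 * Complex.I) with hv₀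
  set v₁ : ℝ → ℂ := fun t => l₁ t * Complex.exp (angle g s Real.pi t / 2 * Complex.I) with hv₁
  have d₀ : ∀ t, HasDerivAt v₀ (-(s / 2) * g t * conj (v₀ t)) t := fun t => by
    have := hp.hasDerivAt_fst t
    simpa only [hv₀, map_mul, Complex.conj_ofReal, conj_exp_half] using this
  have d₁ : ∀ t, HasDerivAt v₁ (-(s / 2) * g t * conj (v₁ t)) t := fun t => by
    have := hq.hasDerivAt_fst t
    simpa only [hv₁, map_mul, Complex.conj_ofReal, conj_exp_half] using this
  have i₀ : v₀ 0 = 1 := by simp [hv₀, h₀0, l₀0]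
  have i₁ : v₁ 0 = Complex.I := by simp [hv₁, h₁0, l₁0, Complex.exp_pi_div_two_mul_I]
  refine ⟨fun t => (v₀ t - Complex.I * v₁ t) / 2, fun t => (v₀ t + Complex.I * v₁ t) / 2,
    fun t => ?_, fun t => ?_, by simp [i₀, i₁], by simp [i₀, i₁]⟩
  · refine (((d₀ t).sub ((d₁ t).const_mul _)).div_const 2).congr_deriv ?_
    simp only [map_add, map_mul, map_div₀, Complex.conj_I, map_ofNat]
    ring
  · refine (((d₀ t).add ((d₁ t).const_mul _)).div_const 2).congr_deriv ?_
    simp only [map_sub, map_mul, map_div₀, Complex.conj_I, map_ofNat]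
    ring

/-- The fundamental matrix has determinant one. -/
theorem IsTransfer.det_eq_one (h : IsTransfer g s α β) (t : ℝ) :
    α t * conj (α t) - β t * conj (β t) = 1 := by
  have key := eq_of_hasDerivAt_zero (f := fun t => α t * conj (α t) - β t * conj (β t))
    (fun t => by
      refine (((h.hasDerivAt_fst t).mul (h.right.hasDerivAt_snd t)).sub
        ((h.hasDerivAt_snd t).mul (h.left.hasDerivAt_snd t))).congr_deriv ?_
      ring) t 0
  simpa [h.fst_zero, h.snd_zero] using key

theorem IsTransfer.normSq_sub_normSq (h : IsTransfer g s α β) (t : ℝ) :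
    Complex.normSq (α t) - Complex.normSq (β t) = 1 := by
  have := h.det_eq_one t
  rw [Complex.mul_conj, Complex.mul_conj] at this
  exact_mod_cast this

/-- Every solution of the linear system is the image of its initial value under the fundamental
matrix. -/
theorem IsLinearPair.eq_transfer {p q : ℝ → ℂ} (h : IsLinearPair g s p q)
    (hT : IsTransfer g s α β) (t : ℝ) :
    p t = α t * p 0 + β t * q 0 ∧ q t = conj (β t) * p 0 + conj (α t) * q 0 := by
  have hd := hT.det_eq_one t
  have k1 := eq_of_hasDerivAt_zero (f := fun t => conj (α t) * p t - β t * q t) (fun t => by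
    refine (((hT.right.hasDerivAt_snd t).mul (h.hasDerivAt_fst t)).sub
      ((hT.hasDerivAt_snd t).mul (h.hasDerivAt_snd t))).congr_deriv ?_
    ring) t 0
  have k2 := eq_of_hasDerivAt_zero (f := fun t => α t * q t - conj (β t) * p t) (fun t => by
    refine (((hT.hasDerivAt_fst t).mul (h.hasDerivAt_snd t)).sub
      ((hT.left.hasDerivAt_snd t).mul (h.hasDerivAt_fst t))).congr_deriv ?_
    ring) t 0
  simp only [hT.fst_zero, hT.snd_zero, map_one, map_zero, one_mul, zero_mul, sub_zero] at k1 k2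
  constructor
  · linear_combination (-p t) * hd + α t * k1 + β t * k2
  · linear_combination (-q t) * hd + conj (β t) * k1 + conj (α t) * k2

theorem IsTransfer.isLinearPair (hT : IsTransfer g s α β) (p₀ q₀ : ℂ) :
    IsLinearPair g s (fun t => α t * p₀ + β t * q₀)
      (fun t => conj (β t) * p₀ + conj (α t) * q₀) where
  hasDerivAt_fst t := by
    refine (((hT.hasDerivAt_fst t).mul_const p₀).add
      ((hT.hasDerivAt_snd t).mul_const q₀)).congr_deriv ?_
    ring
  hasDerivAt_snd t := by
    refine (((hT.left.hasDerivAt_snd t).mul_const p₀).add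
      ((hT.right.hasDerivAt_snd t).mul_const q₀)).congr_deriv ?_
    ring

theorem IsLinearPair.comp_add_period (hp : Function.Periodic g L) {p q : ℝ → ℂ}
    (h : IsLinearPair g s p q) : IsLinearPair g s (fun t => p (t + L)) (fun t => q (t + L)) where
  hasDerivAt_fst t := by
    have := (h.hasDerivAt_fst (t + L)).comp_add_const t L
    rwa [hp t] at this
  hasDerivAt_snd t := by
    have := (h.hasDerivAt_snd (t + L)).comp_add_const t L
    rwa [hp t] at this

/-! ### Trace of the monodromy and rotation number -/

theorem IsAngle.transfer_eq (hg : Continuous g) (hT : IsTransfer g s α β) {θ : ℝ → ℝ}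
    (h : IsAngle g s θ) (t : ℝ) : ∃ l : ℝ, 0 < l ∧ l * Complex.exp (θ t / 2 * Complex.I) =
      α t * Complex.exp (θ 0 / 2 * Complex.I) + β t * Complex.exp (-(θ 0 / 2 * Complex.I)) := by
  obtain ⟨l, hl, hl0, hp⟩ := h.exists_isLinearPair hg
  refine ⟨l t, hl t, ?_⟩
  simpa [hl0] using (hp.eq_transfer hT t).1

/-- A monodromy matrix that is not elliptic has a fixed point on the circle. -/
theorem exists_turning_eq_int (hV : IsPeriodicVelocity g L) (hT : IsTransfer g s α β)
    (h : (α L).im ^ 2 ≤ Complex.normSq (β L)) : ∃ m : ℤ, turning hV s = m := by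
  -- the fixed points are the angles at which `α + β exp (-i θ)` is real
  obtain ⟨θ₀, hθ₀⟩ : ∃ θ₀ : ℝ, (α L + β L * Complex.exp (-(θ₀ * Complex.I))).im = 0 := by
    have hb : Complex.normSq (β L) = ‖β L‖ ^ 2 := Complex.normSq_eq_norm_sq _
    rcases eq_or_ne (β L) 0 with h0 | h0
    · refine ⟨0, ?_⟩
      rw [h0, map_zero] at h
      simpa [h0] using pow_eq_zero_iff (two_ne_zero) |>.mp (le_antisymm h (sq_nonneg _))
    · have hpos : 0 < ‖β L‖ := norm_pos_iff.mpr h0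
      have hle : |(α L).im| ≤ ‖β L‖ := by
        rw [hb] at h
        exact abs_le_of_sq_le_sq h hpos.le
      rw [abs_le] at hle
      refine ⟨Complex.arg (β L) + Real.arcsin ((α L).im / ‖β L‖), ?_⟩
      have e : β L * Complex.exp (-(((Complex.arg (β L) +
          Real.arcsin ((α L).im / ‖β L‖) : ℝ) : ℂ) * Complex.I)) =
          ‖β L‖ * Complex.exp ((-Real.arcsin ((α L).im / ‖β L‖) : ℝ) * Complex.I) := by
        nth_rewrite 1 [← Complex.norm_mul_exp_arg_mul_I (β L)]
        rw [mul_assoc, ← Complex.exp_add]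
        push_cast
        ring_nf
      rw [Complex.add_im, e, Complex.im_ofReal_mul, Complex.exp_ofReal_mul_I_im, Real.sin_neg,
        Real.sin_arcsin]
      · field_simp
        ring
      · rw [le_div_iff₀ hpos]
        linarith
      · rw [div_le_iff₀ hpos]
        linarith
  obtain ⟨hA, hA0⟩ := hV.angle_spec s θ₀
  obtain ⟨l, hl, hleq⟩ := hA.transfer_eq hV.continuous hT L
  rw [hA0] at hleq
  set θ := angle g s θ₀
  have e : (l : ℂ) * Complex.exp (((θ L - θ₀) / 2 : ℝ) * Complex.I) =
      α L + β L * Complex.exp (-(θ₀ * Complex.I)) := by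
    have e1 : Complex.exp (((θ L - θ₀) / 2 : ℝ) * Complex.I) =
        Complex.exp (θ L / 2 * Complex.I) * Complex.exp (-(θ₀ / 2 * Complex.I)) := by
      rw [← Complex.exp_add]
      push_cast
      ring_nf
    have e2 : Complex.exp (-(θ₀ * Complex.I)) =
        Complex.exp (-(θ₀ / 2 * Complex.I)) * Complex.exp (-(θ₀ / 2 * Complex.I)) := by
      rw [← Complex.exp_add]
      ring_nf
    have e3 : Complex.exp (θ₀ / 2 * Complex.I) * Complex.exp (-(θ₀ / 2 * Complex.I)) = 1 := by
      rw [← Complex.exp_add]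
      simp
    rw [e1, e2]
    linear_combination Complex.exp (-(θ₀ / 2 * Complex.I)) * hleq + α L * e3
  rw [← e, Complex.im_ofReal_mul, Complex.exp_ofReal_mul_I_im] at hθ₀
  obtain ⟨m, hm⟩ := Real.sin_eq_zero_iff.mp ((mul_eq_zero.mp hθ₀).resolve_left hl.ne')
  refine ⟨m, (turning_eq_int_iff hV).mpr ⟨θ, hA, ?_⟩⟩
  rw [hA0]
  linarith

/-- A continuous angle whose cosine stays positive is confined to an interval of length `π`. -/
theorem abs_sub_le_pi_of_cos_pos {F : ℝ → ℝ} (hF : Continuous F) (h : ∀ t, 0 < Real.cos (F t))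
    (t u : ℝ) : |F t - F u| ≤ Real.pi := by
  by_contra! hlt
  rcases lt_abs.mp hlt with h1 | h1
  · obtain ⟨w, hw⟩ := mem_range_of_exists_le_of_exists_ge hF
      (c := F u + Real.pi) ⟨u, by linarith [Real.pi_pos]⟩ ⟨t, by linarith⟩
    have := h w
    rw [hw, Real.cos_add_pi] at this
    linarith [h u]
  · obtain ⟨w, hw⟩ := mem_range_of_exists_le_of_exists_ge hF
      (c := F u - Real.pi) ⟨t, by linarith⟩ ⟨u, by linarith [Real.pi_pos]⟩
    have := h w
    rw [hw, Real.cos_sub_pi] at this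
    linarith [h u]

/-- An elliptic monodromy matrix with rotation number `ρ` has the trace `2 cos (π ρ)`; the
sign of `sin (π ρ)` is that of the imaginary part of its diagonal entry. -/
theorem cos_turning_of_elliptic (hV : IsPeriodicVelocity g L) (hT : IsTransfer g s α β)
    (h : Complex.normSq (β L) < (α L).im ^ 2) :
    Real.cos (Real.pi * turning hV s) = (α L).re ∧
      0 < Real.sin (Real.pi * turning hV s) * (α L).im := by
  set a := (α L).im with ha
  set x := (α L).re with hx
  set b := β L with hb
  obtain ⟨σ, hσ, hσa⟩ : ∃ σ : ℝ, σ ^ 2 = a ^ 2 - Complex.normSq b ∧ 0 < σ * a := by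
    have hsq := Real.sq_sqrt (sub_pos.mpr h).le
    have hpos := Real.sqrt_pos.mpr (sub_pos.mpr h)
    rcases lt_trichotomy a 0 with h0 | h0 | h0
    · exact ⟨_, (neg_sq _).trans hsq, mul_pos_of_neg_of_neg (neg_neg_of_pos hpos) h0⟩
    · rw [h0] at h
      linarith [Complex.normSq_nonneg b]
    · exact ⟨_, hsq, mul_pos hpos h0⟩
  have hα : α L = x + a * Complex.I := (Complex.re_add_im _).symm
  have hαc : conj (α L) = x - a * Complex.I := by
    rw [hα]
    simp [sub_eq_add_neg]
  have hbb : b * conj b = (a : ℂ) ^ 2 - (σ : ℂ) ^ 2 := by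
    rw [Complex.mul_conj]
    exact_mod_cast (by linarith : Complex.normSq b = a ^ 2 - σ ^ 2)
  have hunit : x ^ 2 + σ ^ 2 = 1 := by
    have := hT.normSq_sub_normSq L
    rw [Complex.normSq_apply (α L)] at this
    nlinarith
  -- the eigenvector `(i b, a + σ)` for the eigenvalue `x - i σ`
  set μ : ℂ := x - σ * Complex.I with hμ
  set p₀ : ℂ := Complex.I * b with hp₀
  set q₀ : ℂ := a + σ with hq₀
  have hpair := hT.isLinearPair p₀ q₀
  set p : ℝ → ℂ := fun t => α t * p₀ + β t * q₀ with hp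
  set q : ℝ → ℂ := fun t => conj (β t) * p₀ + conj (α t) * q₀ with hq
  have hp0 : p 0 = p₀ := by simp [hp, hT.fst_zero, hT.snd_zero]
  have hq0 : q 0 = q₀ := by simp [hq, hT.fst_zero, hT.snd_zero]
  have hI := Complex.I_sq
  have hpL : p L = μ * p₀ := by
    rw [hp]
    simp only
    rw [hα, hp₀, hq₀, hμ, ← hb]
    linear_combination (a : ℂ) * b * hI + (σ : ℂ) * b * hI
  have hqL : q L = μ * q₀ := by
    rw [hq]
    simp only
    rw [hαc, hp₀, hq₀, hμ, ← hb]
    linear_combination Complex.I * hbb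
  have hper : ∀ t, p (t + L) = μ * p t ∧ q (t + L) = μ * q t := by
    intro t
    have := (hpair.comp_add_period hV.periodic).eq_transfer hT t
    simp only [zero_add] at this
    rw [this.1, this.2, hpL, hqL]
    constructor <;> ring
  have hlt : ∀ t, ‖p t‖ < ‖q t‖ := by
    intro t
    have hn : Complex.normSq (q t) - Complex.normSq (p t) =
        Complex.normSq q₀ - Complex.normSq p₀ := by
      have h1 : ∀ t, q t * conj (q t) - p t * conj (p t) =
          (q₀ * conj q₀ - p₀ * conj p₀) * (α t * conj (α t) - β t * conj (β t)) := by
        intro t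
        simp only [hp, hq, map_add, map_mul, Complex.conj_conj]
        ring
      have h2 := h1 t
      rw [hT.det_eq_one, mul_one] at h2
      simp only [Complex.mul_conj] at h2
      exact_mod_cast h2
    have hp₀n : Complex.normSq p₀ = a ^ 2 - σ ^ 2 := by
      rw [hp₀, Complex.normSq_mul, Complex.normSq_I]
      linarith
    have hq₀n : Complex.normSq q₀ = (a + σ) ^ 2 := by
      rw [hq₀, ← Complex.ofReal_add, Complex.normSq_ofReal]
      ring
    refine lt_of_pow_lt_pow_left₀ 2 (norm_nonneg _) ?_
    rw [← Complex.normSq_eq_norm_sq, ← Complex.normSq_eq_norm_sq]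
    nlinarith [sq_nonneg σ]
  have hq_ne : ∀ t, q t ≠ 0 := fun t h0 => by
    have := hlt t
    rw [h0, norm_zero] at this
    linarith [norm_nonneg (p t)]
  have hμ0 : μ ≠ 0 := fun h0 => hq_ne L (by rw [hqL, h0, zero_mul])
  have hpc : Continuous p := continuous_iff_continuousAt.mpr fun t =>
    (hpair.hasDerivAt_fst t).continuousAt
  have hqc : Continuous q := continuous_iff_continuousAt.mpr fun t =>
    (hpair.hasDerivAt_snd t).continuousAt
  have hq'c : Continuous fun t => -(s / 2) * conj (g t) * p t :=
    (continuous_const.mul (Complex.continuous_conj.comp hV.continuous)).mul hpc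
  set E : ℝ → ℂ := fun t => ∫ u in (0 : ℝ)..t, -(s / 2) * conj (g u) * p u / q u with hE
  have hqE : ∀ t, q t = q₀ * Complex.exp (E t) := fun t => by
    rw [← hq0]
    exact eq_mul_exp_integral hpair.hasDerivAt_snd hq'c hq_ne t
  have hEc : Continuous E := intervalIntegral.continuous_primitive
    (fun _ _ => (hq'c.div hqc hq_ne).intervalIntegrable _ _) 0
  have hEn : ∀ n : ℕ, E (n * L) = n * E L := by
    intro n
    have hperE : Function.Periodic (fun u => -(s / 2) * conj (g u) * p u / q u) L := fun t => by
      simp only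
      rw [hV.periodic t, (hper t).1, (hper t).2]
      have := hq_ne t
      field_simp
    have := hperE.intervalIntegral_add_zsmul_eq n 0
      (fun _ _ => (hq'c.div hqc hq_ne).intervalIntegrable _ _)
    simpa [hE] using this
  have hEL : Complex.exp (E L) = μ := by
    have := hqE L
    rw [hqL, mul_comm] at this
    have h0 := hq_ne 0
    rw [hq0] at h0
    exact (mul_left_cancel₀ h0 this).symm
  -- the Wronskian of an angle solution with `(p, q)` pins the angle to `-2 Im E`
  obtain ⟨hA, hA0⟩ := hV.angle_spec s 0
  set θ := angle g s 0
  obtain ⟨l, hl, hl0, hlp⟩ := hA.exists_isLinearPair hV.continuous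
  have hW : ∀ t, q t * (l t * Complex.exp (θ t / 2 * Complex.I)) -
      p t * (l t * Complex.exp (-(θ t / 2 * Complex.I))) = q₀ - p₀ := by
    intro t
    have := eq_of_hasDerivAt_zero (f := fun t => q t * (l t * Complex.exp (θ t / 2 * Complex.I)) -
      p t * (l t * Complex.exp (-(θ t / 2 * Complex.I)))) (fun t => by
        refine (((hpair.hasDerivAt_snd t).mul (hlp.hasDerivAt_fst t)).sub
          ((hpair.hasDerivAt_fst t).mul (hlp.hasDerivAt_snd t))).congr_deriv ?_
        ring) t 0
    rw [this]
    simp [hA0, hl0, hp0, hq0]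
  set K : ℂ := (q₀ - p₀) / q₀ with hK
  have hq₀_ne : q₀ ≠ 0 := hq0 ▸ hq_ne 0
  have hKW : ∀ t, K * Complex.exp (-(E t + θ t / 2 * Complex.I)) =
      l t * (1 - p t / q t * Complex.exp (-(θ t * Complex.I))) := by
    intro t
    have h1 : q₀ * Complex.exp (E t) * Complex.exp (θ t / 2 * Complex.I) *
        Complex.exp (-(E t + θ t / 2 * Complex.I)) = q₀ := by
      rw [mul_assoc, mul_assoc, ← Complex.exp_add, ← Complex.exp_add]
      simp
    have h2 : Complex.exp (-(θ t / 2 * Complex.I)) =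
        Complex.exp (θ t / 2 * Complex.I) * Complex.exp (-(θ t * Complex.I)) := by
      rw [← Complex.exp_add]
      ring_nf
    have h3 := hW t
    rw [← hqE] at h1
    rw [h2] at h3
    have := hq_ne t
    rw [hK, ← h3, div_mul_eq_mul_div, div_eq_iff hq₀_ne, ← h1]
    field_simp
  -- the factor `1 - (p / q) exp (-i θ)` has positive real part, as `|p / q| < 1`
  have hre : ∀ t, 0 < (K * Complex.exp (-(E t + θ t / 2 * Complex.I))).re := by
    intro t
    rw [hKW, Complex.re_ofReal_mul, Complex.sub_re, Complex.one_re]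
    refine mul_pos (hl t) (sub_pos.mpr ?_)
    refine (Complex.re_le_norm _).trans_lt ?_
    have h1 : ‖Complex.exp (-(θ t * Complex.I))‖ = 1 := by
      rw [neg_mul_eq_neg_mul, ← Complex.ofReal_neg, Complex.norm_exp_ofReal_mul_I]
    rw [norm_mul, norm_div, h1, mul_one, div_lt_one (norm_pos_iff.mpr (hq_ne t))]
    exact hlt t
  have hK0 : K ≠ 0 := fun h0 => by
    have := hre 0
    simp [h0] at this
  set F : ℝ → ℝ := fun t => Complex.arg K - (E t).im - θ t / 2 with hF
  have hcos : ∀ t, 0 < Real.cos (F t) := by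
    intro t
    have e : K * Complex.exp (-(E t + θ t / 2 * Complex.I)) =
        ((‖K‖ * Real.exp (-(E t).re) : ℝ) : ℂ) * Complex.exp (F t * Complex.I) := by
      nth_rewrite 1 [← Complex.norm_mul_exp_arg_mul_I K]
      nth_rewrite 1 [← Complex.re_add_im (E t)]
      rw [mul_assoc, ← Complex.exp_add]
      push_cast [hF]
      rw [mul_assoc, ← Complex.exp_add]
      ring_nf
    have h1 := hre t
    rw [e, Complex.re_ofReal_mul, Complex.exp_ofReal_mul_I_re] at h1
    exact pos_of_mul_pos_right h1 (by positivity)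
  have hFc : Continuous F := (continuous_const.sub (Complex.continuous_im.comp hEc)).sub
    (hA.continuous.div_const 2)
  have hturn : turning hV s = -2 * (E L).im / (2 * Real.pi) := by
    refine hA.turning_eq hV (D := 2 * Real.pi + 2 * |Complex.arg K - F 0|) fun n => ?_
    have h1 := abs_sub_le_pi_of_cos_pos hFc hcos (n * L) 0
    have h2 : θ (n * L) - n * (-2 * (E L).im) =
        -2 * (F (n * L) - F 0) + 2 * (Complex.arg K - F 0) := by
      have h3 : (E (n * L)).im = n * (E L).im := by
        rw [hEn]
        simp
      have h4 : F (n * L) = Complex.arg K - (E (n * L)).im - θ (n * L) / 2 := rfl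
      linarith
    rw [h2]
    refine (abs_add_le _ _).trans ?_
    rw [abs_mul, abs_mul, abs_neg, abs_two]
    gcongr
  have hturn' : Real.pi * turning hV s = -(E L).im := by
    rw [hturn]
    have := Real.pi_pos
    field_simp
  have hEre : (E L).re = 0 := by
    have h1 : Real.exp (E L).re ^ 2 = 1 := by
      rw [← Complex.norm_exp, hEL, ← Complex.normSq_eq_norm_sq, hμ, Complex.normSq_apply]
      simp
      nlinarith
    rw [← Real.exp_nat_mul] at h1
    have := (Real.exp_eq_one_iff _).mp h1
    push_cast at this
    linarith
  have hc : Real.cos (E L).im = x := by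
    have := congrArg Complex.re hEL
    rw [Complex.exp_re, hEre] at this
    simpa [hμ] using this
  have hs : Real.sin (E L).im = -σ := by
    have := congrArg Complex.im hEL
    rw [Complex.exp_im, hEre] at this
    simpa [hμ] using this
  rw [hturn', Real.cos_neg, Real.sin_neg, hc, hs, neg_neg]
  exact ⟨rfl, hσa⟩

/-! ### Derivative of the rotation number -/

theorem IsTransfer.continuous_fst (h : IsTransfer g s α β) : Continuous α :=
  continuous_iff_continuousAt.mpr fun t => (h.hasDerivAt_fst t).continuousAt

theorem IsTransfer.continuous_snd (h : IsTransfer g s α β) : Continuous β :=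
  continuous_iff_continuousAt.mpr fun t => (h.hasDerivAt_snd t).continuousAt

theorem exists_norm_transfer_sub_le (hV : IsPeriodicVelocity g L) {A B : ℝ → ℝ → ℂ}
    (hT : ∀ s, IsTransfer g s (A s) (B s)) (s₀ : ℝ) :
    ∃ D : ℝ, ∀ s, |s - s₀| ≤ 1 → ∀ t ∈ Icc 0 L,
      ‖A s t - A s₀ t‖ ≤ D * |s - s₀| ∧ ‖B s t - B s₀ t‖ ≤ D * |s - s₀| := by
  obtain ⟨C, hC⟩ := hV.exists_norm_le
  set F : ℝ → ℂ × ℂ → ℂ × ℂ := fun t x =>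
    (-(1 / 2) * g t * conj x.2, -(1 / 2) * g t * conj x.1) with hF
  have hK : ∀ t, LipschitzWith C (F t) := fun t => by
    refine LipschitzWith.of_dist_le_mul fun x y => ?_
    have half : ‖-(1 / 2) * g t‖ ≤ C := by
      rw [norm_mul, norm_neg]
      norm_num
      linarith [hC t, norm_nonneg (g t)]
    have comp : ∀ u v : ℂ, dist (-(1 / 2) * g t * conj u) (-(1 / 2) * g t * conj v) ≤
        C * dist u v := fun u v => by
      rw [dist_eq_norm, ← mul_sub, ← map_sub, norm_mul, Complex.norm_conj, ← dist_eq_norm]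
      gcongr
    rw [Prod.dist_eq, Prod.dist_eq]
    refine max_le ((comp _ _).trans ?_) ((comp _ _).trans ?_)
    · exact mul_le_mul_of_nonneg_left (le_max_right _ _) C.coe_nonneg
    · exact mul_le_mul_of_nonneg_left (le_max_left _ _) C.coe_nonneg
  have hy : ∀ s, IsIntegralCurve (fun t => (A s t, B s t)) fun t x => s • F t x := fun s t => by
    refine (((hT s).hasDerivAt_fst t).prodMk ((hT s).hasDerivAt_snd t)).congr_deriv ?_
    simp only [hF, Prod.smul_mk, Complex.real_smul, Prod.mk.injEq]
    constructor <;> ring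
  have hcont : Continuous fun t => F t (A s₀ t, B s₀ t) := by
    have h1 := Complex.continuous_conj.comp (hT s₀).continuous_fst
    have h2 := Complex.continuous_conj.comp (hT s₀).continuous_snd
    exact ((continuous_const.mul hV.continuous).mul h2).prodMk
      ((continuous_const.mul hV.continuous).mul h1)
  obtain ⟨M, hM⟩ := isCompact_Icc.exists_bound_of_continuousOn (s := Icc 0 L) hcont.continuousOn
  obtain ⟨D, hD⟩ := exists_dist_le_mul_of_isIntegralCurve_smul hK
    (y := fun s t => (A s t, B s t)) hy (y₀ := (1, 0))
    (fun s => by simp [(hT s).fst_zero, (hT s).snd_zero]) (s₀ := s₀) hM hV.pos.le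
  refine ⟨D, fun s hs t ht => ?_⟩
  have := hD s hs t ht
  rw [Prod.dist_eq, dist_eq_norm, dist_eq_norm] at this
  exact ⟨(le_max_left _ _).trans this, (le_max_right _ _).trans this⟩

/-- Duhamel's formula for the diagonal entry of the monodromy matrix as a function of the inverse
length. -/
theorem hasDerivAt_transfer (hV : IsPeriodicVelocity g L) {A B : ℝ → ℝ → ℂ}
    (hT : ∀ s, IsTransfer g s (A s) (B s)) (s₀ : ℝ) :
    HasDerivAt (fun s => A s L) (∫ t in (0 : ℝ)..L,
      (1 / 2 * (B s₀ L * conj (B s₀ t) - A s₀ L * conj (A s₀ t)) * g t * conj (B s₀ t) +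
       1 / 2 * (A s₀ L * B s₀ t - B s₀ L * A s₀ t) * conj (g t) * A s₀ t)) s₀ := by
  obtain ⟨D, hD⟩ := exists_norm_transfer_sub_le hV hT s₀
  set h₁ : ℝ → ℂ := fun t =>
    1 / 2 * (B s₀ L * conj (B s₀ t) - A s₀ L * conj (A s₀ t)) * g t with hh₁
  set h₂ : ℝ → ℂ := fun t => 1 / 2 * (A s₀ L * B s₀ t - B s₀ L * A s₀ t) * conj (g t) with hh₂
  have cA := fun s => (hT s).continuous_fst
  have cB := fun s => (hT s).continuous_snd
  have cA' := fun s => Complex.continuous_conj.comp (cA s)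
  have cB' := fun s => Complex.continuous_conj.comp (cB s)
  have cg := hV.continuous
  have cg' := Complex.continuous_conj.comp cg
  have ch₁ : Continuous h₁ := (continuous_const.mul
    ((continuous_const.mul (cB' s₀)).sub (continuous_const.mul (cA' s₀)))).mul cg
  have ch₂ : Continuous h₂ := (continuous_const.mul
    ((continuous_const.mul (cB s₀)).sub (continuous_const.mul (cA s₀)))).mul cg'
  have cJ : ∀ s, Continuous fun t => h₁ t * conj (B s t) + h₂ t * A s t := fun s =>
    (ch₁.mul (cB' s)).add (ch₂.mul (cA s))
  set J : ℝ → ℂ := fun s => ∫ t in (0 : ℝ)..L, (h₁ t * conj (B s t) + h₂ t * A s t) with hJ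
  -- with `U s` the fundamental matrix, integrate the derivative of the first entry of
  -- `U s₀ L * (U s₀ t)⁻¹ * U s t`, which runs from `A s₀ L` at `t = 0` to `A s L` at `t = L`
  have hdiff : ∀ s, A s L - A s₀ L = (s - s₀) * J s := by
    intro s
    have key := intervalIntegral.integral_eq_sub_of_hasDerivAt (a := 0) (b := L)
      (f := fun t => A s₀ L * (conj (A s₀ t) * A s t - B s₀ t * conj (B s t)) +
        B s₀ L * (A s₀ t * conj (B s t) - conj (B s₀ t) * A s t))
      (f' := fun t => (s - s₀) * (h₁ t * conj (B s t) + h₂ t * A s t)) (fun t _ => by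
        have a₀ := (hT s₀).hasDerivAt_fst t
        have b₀ := (hT s₀).hasDerivAt_snd t
        have a₀' := (hT s₀).right.hasDerivAt_snd t
        have b₀' := (hT s₀).left.hasDerivAt_snd t
        have a := (hT s).hasDerivAt_fst t
        have b' := (hT s).left.hasDerivAt_snd t
        refine ((((a₀'.mul a).sub (b₀.mul b')).const_mul _).add
          (((a₀.mul b').sub (b₀'.mul a)).const_mul _)).congr_deriv ?_
        simp only [hh₁, hh₂]
        ring) ((continuous_const.mul (cJ s)).intervalIntegrable _ _)
    rw [intervalIntegral.integral_const_mul] at key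
    simp only [(hT _).fst_zero, (hT _).snd_zero, map_one, map_zero] at key
    rw [hJ]
    simp only
    rw [key]
    linear_combination (-A s L) * (hT s₀).det_eq_one L
  have hlim : Tendsto J (𝓝 s₀) (𝓝 (J s₀)) := by
    obtain ⟨M₁, hM₁⟩ := isCompact_Icc.exists_bound_of_continuousOn (s := Icc 0 L) ch₁.continuousOn
    obtain ⟨M₂, hM₂⟩ := isCompact_Icc.exists_bound_of_continuousOn (s := Icc 0 L) ch₂.continuousOn
    rw [tendsto_iff_dist_tendsto_zero]
    have hz : Tendsto (fun s => (M₁ + M₂) * (D * |s - s₀|) * |L - 0|) (𝓝 s₀) (𝓝 0) := by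
      have : Continuous fun s => (M₁ + M₂) * (D * |s - s₀|) * |L - 0| := by fun_prop
      simpa using this.tendsto s₀
    refine squeeze_zero' (Eventually.of_forall fun _ => dist_nonneg) ?_ hz
    filter_upwards [Metric.closedBall_mem_nhds s₀ one_pos] with s hs
    rw [Metric.mem_closedBall, Real.dist_eq] at hs
    rw [dist_eq_norm, ← intervalIntegral.integral_sub ((cJ s).intervalIntegrable _ _)
      ((cJ s₀).intervalIntegrable _ _)]
    refine intervalIntegral.norm_integral_le_of_norm_le_const fun t ht => ?_
    rw [uIoc_of_le hV.pos.le] at ht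
    have ht' := Ioc_subset_Icc_self ht
    have e : h₁ t * conj (B s t) + h₂ t * A s t - (h₁ t * conj (B s₀ t) + h₂ t * A s₀ t) =
        h₁ t * conj (B s t - B s₀ t) + h₂ t * (A s t - A s₀ t) := by
      rw [map_sub]
      ring
    rw [e]
    refine (norm_add_le _ _).trans ?_
    rw [norm_mul (h₁ t), norm_mul (h₂ t), Complex.norm_conj, add_mul]
    exact add_le_add
      (mul_le_mul (hM₁ t ht') (hD s hs t ht').2 (norm_nonneg _)
        ((norm_nonneg _).trans (hM₁ t ht')))
      (mul_le_mul (hM₂ t ht') (hD s hs t ht').1 (norm_nonneg _)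
        ((norm_nonneg _).trans (hM₂ t ht')))
  rw [hasDerivAt_iff_tendsto_slope]
  refine (hlim.mono_left nhdsWithin_le_nhds).congr' ?_
  filter_upwards [self_mem_nhdsWithin] with s hs
  have hne : ((s - s₀ : ℝ) : ℂ) ≠ 0 := by exact_mod_cast sub_ne_zero.mpr hs
  rw [slope_def_module, hdiff, Complex.real_smul, Complex.ofReal_inv, ← mul_assoc,
    ← Complex.ofReal_sub, inv_mul_cancel₀ hne, one_mul]

/-- The diagonal entry, divided by `i`, of the trace-free part of the monodromy matrix
`[α, β; conj β, conj α]` at time `L`, transported to time `t` by the flow. -/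
noncomputable def diagEntry (α β : ℝ → ℂ) (L t : ℝ) : ℝ :=
  (α L).im * (Complex.normSq (α t) + Complex.normSq (β t)) +
    2 * (conj (β L) * conj (α t) * β t).im

/-- The off-diagonal entry of the transported trace-free part of the monodromy matrix. -/
noncomputable def offDiagEntry (α β : ℝ → ℂ) (L t : ℝ) : ℂ :=
  β L * α t ^ 2 - conj (β L) * β t ^ 2 - 2 * Complex.I * (α L).im * α t * β t

theorem coe_diagEntry (α β : ℝ → ℂ) (L t : ℝ) : (diagEntry α β L t : ℂ) =
    (α L).im * (α t * conj (α t) + β t * conj (β t)) -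
      Complex.I * (conj (β L) * conj (α t) * β t - β L * α t * conj (β t)) := by
  have h := Complex.sub_conj (conj (β L) * conj (α t) * β t)
  simp only [map_mul, Complex.conj_conj] at h
  rw [h, Complex.mul_conj, Complex.mul_conj, diagEntry]
  push_cast
  linear_combination (2 * ((conj (β L) * conj (α t) * β t).im : ℂ)) * Complex.I_sq

theorem IsTransfer.diagEntry_sq (h : IsTransfer g s α β) (t : ℝ) :
    diagEntry α β L t ^ 2 - Complex.normSq (offDiagEntry α β L t) =
      (α L).im ^ 2 - Complex.normSq (β L) := by
  have key : (diagEntry α β L t : ℂ) ^ 2 - offDiagEntry α β L t * conj (offDiagEntry α β L t) =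
      ((α L).im ^ 2 - β L * conj (β L)) * (α t * conj (α t) - β t * conj (β t)) ^ 2 := by
    rw [coe_diagEntry]
    simp only [offDiagEntry, map_sub, map_mul, map_pow, Complex.conj_conj, Complex.conj_I,
      Complex.conj_ofReal, map_ofNat]
    linear_combination ((conj (β L) * conj (α t) * β t - β L * α t * conj (β t)) ^ 2 +
      4 * (α L).im ^ 2 * α t * β t * conj (α t) * conj (β t)) * Complex.I_sq
  rw [h.det_eq_one, one_pow, mul_one, Complex.mul_conj, Complex.mul_conj] at key
  exact_mod_cast key

theorem IsTransfer.continuous_diagEntry (h : IsTransfer g s α β) :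
    Continuous (diagEntry α β L) := by
  have h1 := h.continuous_fst
  have h2 := h.continuous_snd
  exact (continuous_const.mul ((Complex.continuous_normSq.comp h1).add
    (Complex.continuous_normSq.comp h2))).add (continuous_const.mul (Complex.continuous_im.comp
      ((continuous_const.mul (Complex.continuous_conj.comp h1)).mul h2)))

theorem IsTransfer.hasDerivAt_offDiagEntry (h : IsTransfer g s α β) (t : ℝ) :
    HasDerivAt (offDiagEntry α β L) (Complex.I * s * diagEntry α β L t * g t) t := by
  have a := h.hasDerivAt_fst t
  have b := h.hasDerivAt_snd t
  refine ((((a.pow 2).const_mul (β L)).sub ((b.pow 2).const_mul (conj (β L)))).sub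
    (((a.const_mul (2 * Complex.I * (α L).im)).mul b))).congr_deriv ?_
  rw [coe_diagEntry]
  push_cast
  linear_combination (s * g t * (conj (β L) * conj (α t) * β t - β L * α t * conj (β t))) *
    Complex.I_sq

/-- The transported trace-free part of the monodromy matrix is periodic. -/
theorem IsTransfer.offDiagEntry_period (h : IsTransfer g s α β) :
    offDiagEntry α β L L = offDiagEntry α β L 0 := by
  have h1 := Complex.sub_conj (α L)
  have h2 := h.det_eq_one L
  push_cast at h1
  simp only [offDiagEntry, h.fst_zero, h.snd_zero]
  linear_combination (-α L * β L) * h1 * (-1) + β L * h2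

/-- Derivative of half the trace of the monodromy matrix: an integration by parts turns the
velocity of the front track into its areal velocity. -/
theorem hasDerivAt_re_transfer (hV : IsPeriodicVelocity g L) {A B : ℝ → ℝ → ℂ}
    (hT : ∀ s, IsTransfer g s (A s) (B s)) {Γ : ℝ → ℂ} (hΓ : ∀ t, HasDerivAt Γ (g t) t)
    (hΓL : Γ L = Γ 0) (s : ℝ) :
    HasDerivAt (fun s => (A s L).re)
      (-(s / 2) * ∫ t in (0 : ℝ)..L, diagEntry (A s) (B s) L t * det (Γ t) (g t)) s := by
  have hΓc : Continuous Γ := continuous_iff_continuousAt.mpr fun t => (hΓ t).continuousAt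
  have hg := hV.continuous
  have cA := (hT s).continuous_fst
  have cB := (hT s).continuous_snd
  have cA' := Complex.continuous_conj.comp cA
  have cB' := Complex.continuous_conj.comp cB
  have cg' := Complex.continuous_conj.comp hg
  set n := offDiagEntry (A s) (B s) L with hn
  set m := diagEntry (A s) (B s) L with hm
  have hmc : Continuous m := (hT s).continuous_diagEntry
  have hn' : ∀ t, HasDerivAt n (Complex.I * s * m t * g t) t := (hT s).hasDerivAt_offDiagEntry
  have hnc : Continuous n := continuous_iff_continuousAt.mpr fun t => (hn' t).continuousAt
  have hre := (Complex.reCLM.hasFDerivAt.comp_hasDerivAt s (hasDerivAt_transfer hV hT s))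
  refine hre.congr_deriv ?_
  have hdc : Continuous fun t => m t * det (Γ t) (g t) := by
    unfold det
    fun_prop
  have hsdc : Continuous fun t => s * (m t * det (Γ t) (g t)) := continuous_const.mul hdc
  have cgn : Continuous fun t => (conj (g t) * n t).re :=
    Complex.continuous_re.comp (cg'.mul hnc)
  have hcint : Continuous fun t =>
      (1 / 2 * (B s L * conj (B s t) - A s L * conj (A s t)) * g t * conj (B s t) +
       1 / 2 * (A s L * B s t - B s L * A s t) * conj (g t) * A s t) :=
    (((continuous_const.mul ((continuous_const.mul cB').sub (continuous_const.mul cA'))).mul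
      hg).mul cB').add (((continuous_const.mul ((continuous_const.mul cB).sub
        (continuous_const.mul cA))).mul cg').mul cA)
  rw [← ContinuousLinearMap.intervalIntegral_comp_comm _ (hcint.intervalIntegrable _ _)]
  have step : ∫ t in (0 : ℝ)..L, Complex.reCLM
      (1 / 2 * (B s L * conj (B s t) - A s L * conj (A s t)) * g t * conj (B s t) +
       1 / 2 * (A s L * B s t - B s L * A s t) * conj (g t) * A s t) =
      ∫ t in (0 : ℝ)..L, -(1 / 2) * (conj (g t) * n t).re := by
    refine intervalIntegral.integral_congr fun t _ => ?_
    simp only [Complex.reCLM_apply, hn, offDiagEntry, pow_two]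
    simp [Complex.mul_re, Complex.mul_im]
    ring
  have parts : ∫ t in (0 : ℝ)..L, ((conj (g t) * n t).re - s * (m t * det (Γ t) (g t))) = 0 := by
    have := intervalIntegral.integral_eq_sub_of_hasDerivAt (a := 0) (b := L)
      (f := fun t => (conj (Γ t) * n t).re)
      (f' := fun t => (conj (g t) * n t).re - s * (m t * det (Γ t) (g t))) (fun t _ => by
        have := Complex.reCLM.hasFDerivAt.comp_hasDerivAt t
          ((hasDerivAt_conj (hΓ t)).mul (hn' t))
        refine this.congr_deriv ?_
        simp [det]
        ring) ((cgn.sub hsdc).intervalIntegrable _ _)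
    rw [this, hΓL, hn, (hT s).offDiagEntry_period, sub_self]
  rw [intervalIntegral.integral_sub (cgn.intervalIntegrable _ _)
    (hsdc.intervalIntegrable _ _), intervalIntegral.integral_const_mul] at parts
  rw [step, intervalIntegral.integral_const_mul]
  linarith

/-- At an elliptic length the rotation number is differentiable in the inverse length `s`; its
derivative is the integral of the areal velocity against a weight that is at least one. -/
theorem exists_hasDerivAt_turning (hV : IsPeriodicVelocity g L) {Γ : ℝ → ℂ}
    (hΓ : ∀ t, HasDerivAt Γ (g t) t) (hΓL : Γ L = Γ 0) {s : ℝ}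
    (hs : ∀ m : ℤ, turning hV s ≠ m) :
    ∃ w : ℝ → ℝ, Continuous w ∧ (∀ t, 1 ≤ w t) ∧
      HasDerivAt (turning hV) (s / (2 * Real.pi) * ∫ t in (0 : ℝ)..L, w t * det (Γ t) (g t)) s := by
  choose A B hT using hV.exists_isTransfer
  have hell : Complex.normSq (B s L) < (A s L).im ^ 2 := by
    by_contra! h
    obtain ⟨m, hm⟩ := exists_turning_eq_int hV (hT s) h
    exact hs m hm
  obtain ⟨hcos, hsin⟩ := cos_turning_of_elliptic hV (hT s) hell
  set x : ℝ → ℝ := fun s => (A s L).re with hx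
  set σ := Real.sin (Real.pi * turning hV s) with hσ
  have hσ0 : σ ≠ 0 := fun h => by simp [h] at hsin
  have hxd := hasDerivAt_re_transfer hV hT hΓ hΓL s
  have normSq_eq : ∀ s, x s ^ 2 + (A s L).im ^ 2 - Complex.normSq (B s L) = 1 := fun s => by
    have := (hT s).normSq_sub_normSq L
    rw [Complex.normSq_apply (A s L)] at this
    simp only [hx]
    linarith
  have hx1 : x s ^ 2 < 1 := by linarith [normSq_eq s]
  have hev : ∀ᶠ s' in 𝓝 s, Real.cos (Real.pi * turning hV s') = x s' := by
    have hc : ContinuousAt (fun s => x s ^ 2) s := hxd.continuousAt.pow 2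
    filter_upwards [hc.eventually_lt continuousAt_const hx1] with s' hs'
    exact (cos_turning_of_elliptic hV (hT s') (by linarith [normSq_eq s'])).1
  have hf : HasStrictDerivAt (fun r => Real.cos (Real.pi * r)) (-σ * (Real.pi * 1))
      (turning hV s) :=
    (Real.hasStrictDerivAt_cos _).comp _ ((hasStrictDerivAt_id _).const_mul Real.pi)
  have hf0 : -σ * (Real.pi * 1) ≠ 0 := by
    rw [mul_one]
    exact mul_ne_zero (neg_ne_zero.mpr hσ0) Real.pi_ne_zero
  have hinv := (hf.to_localInverse hf0).hasDerivAt
  have hleft := (continuous_turning hV).continuousAt.eventually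
    (HasStrictDerivAt.eventually_left_inverse hf hf0)
  have hr : HasDerivAt (turning hV) ((-σ * (Real.pi * 1))⁻¹ *
      (-(s / 2) * ∫ t in (0 : ℝ)..L, diagEntry (A s) (B s) L t * det (Γ t) (g t))) s := by
    rw [hcos] at hinv
    refine (hinv.comp s hxd).congr_of_eventuallyEq ?_
    filter_upwards [hev, hleft] with s' h1 h2
    simp only [Function.comp_apply]
    rw [← h2, h1]
  have hσ2 : σ ^ 2 = (A s L).im ^ 2 - Complex.normSq (B s L) := by
    have := Real.sin_sq_add_cos_sq (Real.pi * turning hV s)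
    rw [hcos] at this
    have := normSq_eq s
    simp only [hx] at this
    linarith
  set w : ℝ → ℝ := fun t => diagEntry (A s) (B s) L t / σ with hw
  have hwc : Continuous w := (hT s).continuous_diagEntry.div_const _
  have hw2 : ∀ t, 1 ≤ w t ^ 2 := fun t => by
    have := (hT s).diagEntry_sq (L := L) t
    rw [hw]
    simp only
    rw [div_pow, one_le_div (by positivity), hσ2]
    linarith [Complex.normSq_nonneg (offDiagEntry (A s) (B s) L t)]
  have hw0 : 0 < w 0 := by
    have : diagEntry (A s) (B s) L 0 = (A s L).im := by
      simp [diagEntry, (hT s).fst_zero, (hT s).snd_zero]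
    rw [hw]
    simp only
    rw [this, show (A s L).im / σ = σ * (A s L).im / σ ^ 2 by field_simp]
    positivity
  refine ⟨w, hwc, fun t => ?_, hr.congr_deriv ?_⟩
  · by_contra! hlt
    have hneg : w t ≤ 0 := by nlinarith [hw2 t]
    obtain ⟨u, hu⟩ := mem_range_of_exists_le_of_exists_ge hwc (c := 0) ⟨t, hneg⟩ ⟨0, hw0.le⟩
    have := hw2 u
    rw [hu] at this
    norm_num at this
  · have e : ∀ t, w t * det (Γ t) (g t) =
        σ⁻¹ * (diagEntry (A s) (B s) L t * det (Γ t) (g t)) := fun t => by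
      rw [hw]
      ring
    simp only [e]
    rw [intervalIntegral.integral_const_mul]
    have := Real.pi_ne_zero
    field_simp

theorem im_div_eq_det_div (z w : ℂ) : (w / z).im = det z w / ‖z‖ ^ 2 := by
  rw [Complex.div_im, ← Complex.normSq_eq_norm_sq, det]
  ring

/-! ### Short and long bicycles -/

/-- For short bicycles the rear wheel trails the front wheel: some solution stays within a right
angle of the direction opposite to the velocity, so the rotation number is that of the velocity. -/
theorem exists_turning_eq_of_lt (hV : IsPeriodicVelocity g L) {g' : ℝ → ℂ}
    (hg : ∀ t, HasDerivAt g (g' t) t) (hg' : Continuous g') (hp' : Function.Periodic g' L)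
    (h0 : ∀ t, g t ≠ 0) :
    ∃ s₁ : ℝ, ∀ s, s₁ < s →
      turning hV s = (∫ t in (0 : ℝ)..L, (g' t / g t).im) / (2 * Real.pi) := by
  have hnorm : Continuous fun t => (‖g t‖ : ℂ) := Complex.continuous_ofReal.comp hV.continuous.norm
  obtain ⟨C, hC⟩ := exists_norm_le_of_periodic (L := L) (f := fun t => g' t / (g t * ‖g t‖))
    (hg'.div (hV.continuous.mul hnorm) fun t => mul_ne_zero (h0 t) (by simpa using h0 t))
    (fun t => by simp only [hp' t, hV.periodic t]) hV.pos
  refine ⟨C, fun s hs => ?_⟩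
  have hqc : Continuous fun t => g' t / g t := hg'.div hV.continuous h0
  have hkc : Continuous fun t => (g' t / g t).im := Complex.continuous_im.comp hqc
  set τ : ℝ → ℝ := fun t => Complex.arg (g 0) + ∫ u in (0 : ℝ)..t, (g' u / g u).im with hτ
  have hτ' : ∀ t, HasDerivAt τ (g' t / g t).im t := fun t =>
    (intervalIntegral.integral_hasDerivAt_right (hkc.intervalIntegrable _ _)
      hkc.aestronglyMeasurable.stronglyMeasurableAtFilter hkc.continuousAt).const_add _
  have hpolar : ∀ t, g t = ‖g t‖ * Complex.exp (τ t * Complex.I) := by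
    intro t
    have h1 := eq_mul_exp_integral hg hg' h0 t
    set E := ∫ u in (0 : ℝ)..t, g' u / g u with hE
    have him : E.im = ∫ u in (0 : ℝ)..t, (g' u / g u).im := by
      have := Complex.imCLM.intervalIntegral_comp_comm
        (hqc.intervalIntegrable (μ := MeasureTheory.volume) 0 t)
      simpa using this.symm
    have h2 : ‖g t‖ = ‖g 0‖ * Real.exp E.re := by rw [h1, norm_mul, Complex.norm_exp]
    have hτt : τ t = Complex.arg (g 0) + E.im := by rw [him]
    rw [h2, hτt, h1]
    nth_rewrite 1 [← Complex.norm_mul_exp_arg_mul_I (g 0), ← Complex.re_add_im E]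
    push_cast
    rw [mul_assoc, mul_assoc, ← Complex.exp_add, ← Complex.exp_add]
    ring_nf
  have hfield : ∀ t x, angularField g t (x + τ t + Real.pi) = -(‖g t‖ * Real.sin x) := by
    intro t x
    have hre : (g t).re = ‖g t‖ * Real.cos (τ t) := by
      nth_rewrite 1 [hpolar t]
      rw [Complex.re_ofReal_mul, Complex.exp_ofReal_mul_I_re]
    have him : (g t).im = ‖g t‖ * Real.sin (τ t) := by
      nth_rewrite 1 [hpolar t]
      rw [Complex.im_ofReal_mul, Complex.exp_ofReal_mul_I_im]
    rw [angularField, hre, him, Real.sin_add_pi, Real.cos_add_pi]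
    have := Real.sin_sub (x + τ t) (τ t)
    rw [add_sub_cancel_right] at this
    rw [this]
    ring
  have hk : ∀ t, |(g' t / g t).im| < s * ‖g t‖ := by
    intro t
    have hpos := norm_pos_iff.mpr (h0 t)
    have h1 := hC t
    rw [norm_div, norm_mul, Complex.norm_real, norm_norm, ← div_div, ← norm_div,
      div_le_iff₀ hpos] at h1
    calc _ ≤ ‖g' t / g t‖ := Complex.abs_im_le_norm _
      _ ≤ C * ‖g t‖ := h1
      _ < s * ‖g t‖ := by gcongr
  obtain ⟨hA, hA0⟩ := hV.angle_spec s (τ 0 + Real.pi)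
  set θ := angle g s (τ 0 + Real.pi)
  set y : ℝ → ℝ := fun t => θ t - τ t - Real.pi with hy
  have hy' : ∀ t, HasDerivAt y (-(s * ‖g t‖ * Real.sin (y t)) - (g' t / g t).im) t := by
    intro t
    refine (((hA t).sub (hτ' t)).sub_const Real.pi).congr_deriv ?_
    have : θ t = y t + τ t + Real.pi := by simp only [hy]; ring
    simp only [this, hfield, smul_eq_mul]
    ring
  have hy0 : y 0 = 0 := by simp [hy, hA0]
  have hyc : Continuous y := continuous_iff_continuousAt.mpr fun t => (hy' t).continuousAt
  -- the vector field points inwards at both ends of `[-π / 2, π / 2]`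
  have hbound : ∀ t, 0 ≤ t → |y t| ≤ Real.pi / 2 := by
    intro t ht
    have hpi := Real.pi_pos
    rw [abs_le']
    constructor
    · refine image_le_of_deriv_right_lt_deriv_boundary (a := 0) (b := t) (B := fun _ => Real.pi / 2)
        (B' := fun _ => 0) hyc.continuousOn (fun u _ => (hy' u).hasDerivWithinAt)
        (by rw [hy0]; positivity) (fun u => hasDerivAt_const u _) (fun u _ hu => ?_) ⟨ht, le_rfl⟩
      rw [hu, Real.sin_pi_div_two]
      linarith [(abs_lt.mp (hk u)).1]
    · refine image_le_of_deriv_right_lt_deriv_boundary (a := 0) (b := t) (B := fun _ => Real.pi / 2)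
        (B' := fun _ => 0) hyc.neg.continuousOn (fun u _ => (hy' u).neg.hasDerivWithinAt)
        (by rw [Pi.neg_apply, hy0, neg_zero]; positivity) (fun u => hasDerivAt_const u _)
        (fun u _ hu => ?_) ⟨ht, le_rfl⟩
      have hu' : y u = -(Real.pi / 2) := by
        rw [Pi.neg_apply] at hu
        linarith
      rw [hu', Real.sin_neg, Real.sin_pi_div_two]
      linarith [(abs_lt.mp (hk u)).2]
  refine hA.turning_eq hV (D := Real.pi / 2 + |Complex.arg (g 0) + Real.pi|) fun n => ?_
  have hper : Function.Periodic (fun t => (g' t / g t).im) L := fun t => by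
    simp only [hp' t, hV.periodic t]
  have hn := hper.intervalIntegral_add_zsmul_eq n 0 (fun _ _ => hkc.intervalIntegrable _ _)
  simp only [zero_add, natCast_zsmul, nsmul_eq_mul] at hn
  have e : θ (n * L) - n * ∫ t in (0 : ℝ)..L, (g' t / g t).im =
      y (n * L) + (Complex.arg (g 0) + Real.pi) := by
    simp only [hy, hτ, hn]
    ring
  rw [e]
  refine (abs_add_le _ _).trans ?_
  gcongr
  exact hbound _ (mul_nonneg n.cast_nonneg hV.pos.le)

/-- A solution that returns to its initial value after one period bounds the area of the front
track by a multiple of the inverse length. -/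
theorem exists_abs_integral_det_le (hV : IsPeriodicVelocity g L) {Γ : ℝ → ℂ}
    (hΓ : ∀ t, HasDerivAt Γ (g t) t) (hΓL : Γ L = Γ 0) :
    ∃ C : ℝ, ∀ s, 0 < s → ∀ θ, IsAngle g s θ → θ L = θ 0 →
      |∫ t in (0 : ℝ)..L, det (Γ t) (g t)| ≤ C * s := by
  have hΓc : Continuous Γ := continuous_iff_continuousAt.mpr fun t => (hΓ t).continuousAt
  have hg := hV.continuous
  obtain ⟨M, hM⟩ := isCompact_Icc.exists_bound_of_continuousOn (s := Icc 0 L) hΓc.continuousOn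
  obtain ⟨C, hC⟩ := hV.exists_norm_le
  refine ⟨C * M ^ 2 * L, fun s hs θ hθ hθL => ?_⟩
  have hθc := hθ.continuous
  -- the components of the front wheel along and across the frame
  set X : ℝ → ℝ := fun t => (Γ t).re * Real.cos (θ t) + (Γ t).im * Real.sin (θ t) with hX
  set Y : ℝ → ℝ := fun t => (Γ t).re * Real.sin (θ t) - (Γ t).im * Real.cos (θ t) with hY
  set G : ℝ → ℝ := fun t => angularField g t (θ t) with hG
  have hGc : Continuous G := by
    simp only [hG, angularField]
    fun_prop
  have hθ' : ∀ t, HasDerivAt θ (s * G t) t := hθ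
  have hre : ∀ t, HasDerivAt (fun t => (Γ t).re) (g t).re t := fun t =>
    Complex.reCLM.hasFDerivAt.comp_hasDerivAt t (hΓ t)
  have him : ∀ t, HasDerivAt (fun t => (Γ t).im) (g t).im t := fun t =>
    Complex.imCLM.hasFDerivAt.comp_hasDerivAt t (hΓ t)
  have hX' : ∀ t, HasDerivAt X
      ((g t).re * Real.cos (θ t) + (g t).im * Real.sin (θ t) - s * G t * Y t) t := fun t => by
    refine (((hre t).mul (hθ' t).cos).add ((him t).mul (hθ' t).sin)).congr_deriv ?_
    simp only [hY]
    ring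
  have hY' : ∀ t, HasDerivAt Y (G t + s * G t * X t) t := fun t => by
    refine (((hre t).mul (hθ' t).sin).sub ((him t).mul (hθ' t).cos)).congr_deriv ?_
    simp only [hX, hG, angularField]
    ring
  have hXc : Continuous X := continuous_iff_continuousAt.mpr fun t => (hX' t).continuousAt
  have hYc : Continuous Y := continuous_iff_continuousAt.mpr fun t => (hY' t).continuousAt
  have hdc : Continuous fun t => det (Γ t) (g t) := by
    unfold det
    fun_prop
  have hRc : Continuous fun t => s * G t * (X t ^ 2 - Y t ^ 2) := by fun_prop
  have key := intervalIntegral.integral_eq_sub_of_hasDerivAt (a := 0) (b := L)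
    (f := fun t => 2 / s ^ 2 * (s * Y t - θ t) - X t * Y t)
    (f' := fun t => -(det (Γ t) (g t) + s * G t * (X t ^ 2 - Y t ^ 2))) (fun t _ => by
      refine (((((hY' t).const_mul s).sub (hθ' t)).const_mul _).sub
        ((hX' t).mul (hY' t))).congr_deriv ?_
      have h1 := Real.sin_sq_add_cos_sq (θ t)
      have e : 2 / s ^ 2 * (s * (G t + s * G t * X t) - s * G t) = 2 * (G t * X t) := by
        field_simp
        ring
      rw [e]
      simp only [hX, hY, hG, angularField, det]
      linear_combination ((Γ t).re * (g t).im - (Γ t).im * (g t).re) * (-1) * h1)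
    ((hdc.add hRc).neg.intervalIntegrable _ _)
  have hends : X L = X 0 ∧ Y L = Y 0 := by simp [hX, hY, hθL, hΓL]
  rw [hends.1, hends.2, hθL, sub_self, intervalIntegral.integral_neg, neg_eq_zero,
    intervalIntegral.integral_add (hdc.intervalIntegrable _ _) (hRc.intervalIntegrable _ _)] at key
  rw [eq_neg_of_add_eq_zero_left key, abs_neg]
  have hb := intervalIntegral.norm_integral_le_of_norm_le_const (a := 0) (b := L)
    (f := fun t => s * G t * (X t ^ 2 - Y t ^ 2)) (C := s * C * M ^ 2) (fun t ht => by
      rw [uIoc_of_le hV.pos.le] at ht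
      have h1 : X t ^ 2 + Y t ^ 2 = ‖Γ t‖ ^ 2 := by
        rw [← Complex.normSq_eq_norm_sq, Complex.normSq_apply]
        simp only [hX, hY]
        linear_combination ((Γ t).re ^ 2 + (Γ t).im ^ 2) * Real.sin_sq_add_cos_sq (θ t)
      have h2 : ‖Γ t‖ ^ 2 ≤ M ^ 2 := by
        gcongr
        exact hM t (Ioc_subset_Icc_self ht)
      have h3 : |X t ^ 2 - Y t ^ 2| ≤ M ^ 2 := by
        rw [abs_le]
        constructor <;> nlinarith [sq_nonneg (X t), sq_nonneg (Y t)]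
      rw [Real.norm_eq_abs, abs_mul, abs_mul, abs_of_pos hs]
      gcongr
      exact (abs_angularField_le g t _).trans (hC t))
  rw [Real.norm_eq_abs, sub_zero, abs_of_pos hV.pos] at hb
  linarith

/-! ### Star-shaped curves -/

/-- A continuous function on the line that is locally injective is injective. -/
theorem injective_of_locally_injective {f : ℝ → ℝ} (hf : Continuous f)
    (h : ∀ c, ∃ U ∈ 𝓝 c, InjOn f U) : Function.Injective f := by
  have main : ∀ a b, a < b → f a ≠ f b := by
    intro a b hab heq
    obtain ⟨c, -, hc⟩ := exists_isLocalExtr_Ioo hab hf.continuousOn heq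
    obtain ⟨U, hU, hinj⟩ := h c
    have both : ∀ P : ℝ → Prop, (∀ᶠ x in 𝓝 c, P x) →
        ∃ δ, 0 < δ ∧ P (c - δ) ∧ P (c + δ) ∧ InjOn f (Icc (c - δ) (c + δ)) := by
      intro P hP
      obtain ⟨ε, hε, hball⟩ := Metric.eventually_nhds_iff_ball.mp (hP.and hU)
      have hsub : Icc (c - ε / 2) (c + ε / 2) ⊆ Metric.ball c ε := by
        rw [← Real.closedBall_eq_Icc]
        exact Metric.closedBall_subset_ball (half_lt_self hε)
      exact ⟨ε / 2, by positivity, (hball _ (hsub ⟨le_rfl, by linarith⟩)).1,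
        (hball _ (hsub ⟨by linarith, le_rfl⟩)).1, hinj.mono fun y hy => (hball y (hsub hy)).2⟩
    have mono : ∀ δ, 0 < δ → InjOn f (Icc (c - δ) (c + δ)) →
        (f (c - δ) < f c ∧ f c < f (c + δ)) ∨ (f c < f (c - δ) ∧ f (c + δ) < f c) := by
      intro δ hδ hi
      have hl : c - δ ∈ Icc (c - δ) (c + δ) := ⟨le_rfl, by linarith⟩
      have hm : c ∈ Icc (c - δ) (c + δ) := ⟨by linarith, by linarith⟩
      have hr : c + δ ∈ Icc (c - δ) (c + δ) := ⟨by linarith, le_rfl⟩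
      rcases hf.continuousOn.strictMonoOn_of_injOn_Icc' (by linarith) hi with hs | hs
      · exact Or.inl ⟨hs hl hm (by linarith), hs hm hr (by linarith)⟩
      · exact Or.inr ⟨hs hl hm (by linarith), hs hm hr (by linarith)⟩
    rcases hc with hc | hc
    · obtain ⟨δ, hδ, h1, h2, hi⟩ := both (fun x => f c ≤ f x) hc
      rcases mono δ hδ hi with h3 | h3 <;> linarith [h3.1, h3.2]
    · obtain ⟨δ, hδ, h1, h2, hi⟩ := both (fun x => f x ≤ f c) hc
      rcases mono δ hδ hi with h3 | h3 <;> linarith [h3.1, h3.2]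
  intro a b hab
  rcases lt_trichotomy a b with h1 | h1 | h1
  · exact absurd hab (main a b h1)
  · exact h1
  · exact absurd hab.symm (main b a h1)

/-- A regular curve is locally injective. -/
theorem exists_injOn_of_hasDerivAt {Γ : ℝ → ℂ} (hΓ : ∀ t, HasDerivAt Γ (g t) t)
    (hg : Continuous g) {c : ℝ} (h0 : g c ≠ 0) : ∃ U ∈ 𝓝 c, InjOn Γ U := by
  set F : ℝ → ℝ := fun t => (Γ t * conj (g c)).re with hF
  have hF' : ∀ t, HasDerivAt F (g t * conj (g c)).re t := fun t =>
    Complex.reCLM.hasFDerivAt.comp_hasDerivAt t ((hΓ t).mul_const _)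
  have hpos : ∀ᶠ t in 𝓝 c, 0 < (g t * conj (g c)).re := by
    have hc : Continuous fun t => (g t * conj (g c)).re :=
      Complex.continuous_re.comp (hg.mul continuous_const)
    refine hc.continuousAt.eventually_const_lt ?_
    simp only [Complex.mul_conj, Complex.ofReal_re]
    exact Complex.normSq_pos.mpr h0
  obtain ⟨ε, hε, hball⟩ := Metric.eventually_nhds_iff_ball.mp hpos
  refine ⟨Metric.ball c ε, Metric.ball_mem_nhds c hε, fun x hx y hy hxy => ?_⟩
  refine (strictMonoOn_of_deriv_pos (f := F) (convex_ball c ε)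
    (fun t _ => (hF' t).continuousAt.continuousWithinAt) fun t ht => ?_).injOn hx hy ?_
  · rw [(hF' t).deriv]
    exact hball t (interior_subset ht)
  · simp only [hF, hxy]

/-- The areal velocity of a regular curve about a point with respect to which it is star-shaped
has a constant sign and does not vanish identically: the polar angle is injective, because it
determines the point of the curve and the curve is locally injective. -/
theorem det_sign_of_isStarShaped {Γ : ℝ → ℂ} (hΓ : ∀ t, HasDerivAt Γ (g t) t)
    (hg : Continuous g) (h0 : ∀ t, g t ≠ 0) (hstar : IsStarShaped (range Γ)) :
    ∃ z₀ : ℂ, ((∀ t, 0 ≤ det (Γ t - z₀) (g t)) ∨ (∀ t, det (Γ t - z₀) (g t) ≤ 0)) ∧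
      ∃ t, det (Γ t - z₀) (g t) ≠ 0 := by
  obtain ⟨z₀, hz⟩ := hstar
  have hray : ∀ t t' : ℝ, ∀ c : ℝ, 0 ≤ c → Γ t' - z₀ ≠ 0 → Γ t - z₀ = c * (Γ t' - z₀) →
      Γ t = Γ t' := by
    intro t t' c hc hne heq
    have hn : (‖Γ t' - z₀‖ : ℂ) ≠ 0 := by simpa using hne
    have hu : ‖(Γ t' - z₀) / ‖Γ t' - z₀‖‖ = 1 := by
      rw [norm_div, Complex.norm_real, norm_norm, div_self (norm_ne_zero_iff.mpr hne)]
    refine (hz _ hu).unique ⟨mem_range_self t, c * ‖Γ t' - z₀‖, by positivity, ?_⟩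
      ⟨mem_range_self t', ‖Γ t' - z₀‖, norm_nonneg _, ?_⟩
    · push_cast
      rw [mul_assoc, mul_div_cancel₀ _ hn, ← heq]
      ring
    · rw [mul_div_cancel₀ _ hn]
      ring
  have hne : ∀ t, Γ t - z₀ ≠ 0 := by
    intro t ht
    have hconst : Γ = fun _ => Γ t := by
      funext u
      by_cases hu : Γ u - z₀ = 0
      · exact sub_left_injective (hu.trans ht.symm)
      · exact (hray t u 0 le_rfl hu (by rw [ht]; simp)).symm
    have h1 := hΓ t
    rw [hconst] at h1
    exact h0 t (h1.unique (hasDerivAt_const t _))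
  have hγ : ∀ t, HasDerivAt (fun t => Γ t - z₀) (g t) t := fun t => (hΓ t).sub_const z₀
  have hΓc : Continuous fun t => Γ t - z₀ :=
    continuous_iff_continuousAt.mpr fun t => (hγ t).continuousAt
  have hqc : Continuous fun t => g t / (Γ t - z₀) := hg.div hΓc hne
  set E : ℝ → ℂ := fun t => ∫ u in (0 : ℝ)..t, g u / (Γ u - z₀) with hE
  have hE' : ∀ t, HasDerivAt E (g t / (Γ t - z₀)) t := fun t =>
    intervalIntegral.integral_hasDerivAt_right (hqc.intervalIntegrable _ _)
      hqc.aestronglyMeasurable.stronglyMeasurableAtFilter hqc.continuousAt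
  have hexp := fun t => eq_mul_exp_integral hγ hg hne t
  set φ : ℝ → ℝ := fun t => (E t).im with hφ
  have hφ' : ∀ t, HasDerivAt φ (det (Γ t - z₀) (g t) / ‖Γ t - z₀‖ ^ 2) t := fun t => by
    rw [← im_div_eq_det_div]
    exact Complex.imCLM.hasFDerivAt.comp_hasDerivAt t (hE' t)
  have hφc : Continuous φ := continuous_iff_continuousAt.mpr fun t => (hφ' t).continuousAt
  have hφΓ : ∀ t t', φ t = φ t' → Γ t = Γ t' := by
    intro t t' h
    refine hray t t' (Real.exp ((E t).re - (E t').re)) (Real.exp_pos _).le (hne t') ?_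
    rw [hexp t, hexp t']
    change _ * Complex.exp (E t) = _ * (_ * Complex.exp (E t'))
    have h1 : E t = ((E t).re - (E t').re : ℝ) + E t' := by
      apply Complex.ext
      · simp
      · simpa using h
    nth_rewrite 1 [h1]
    rw [Complex.exp_add, Complex.ofReal_exp]
    ring
  have hinj : Function.Injective φ := injective_of_locally_injective hφc fun c => by
    obtain ⟨U, hU, hi⟩ := exists_injOn_of_hasDerivAt hΓ hg (h0 c)
    exact ⟨U, hU, fun x hx y hy hxy => hi hx hy (hφΓ x y hxy)⟩
  have hnpos : ∀ t, 0 < ‖Γ t - z₀‖ ^ 2 := fun t => pow_pos (norm_pos_iff.mpr (hne t)) 2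
  refine ⟨z₀, ?_, ?_⟩
  · rcases hφc.strictMono_of_inj hinj with hm | hm
    · refine Or.inl fun t => ?_
      have := hm.monotone.deriv_nonneg (x := t)
      rw [(hφ' t).deriv] at this
      by_contra! hlt
      exact absurd this (not_le.mpr (div_neg_of_neg_of_pos hlt (hnpos t)))
    · refine Or.inr fun t => ?_
      have := hm.antitone.deriv_nonpos (x := t)
      rw [(hφ' t).deriv] at this
      by_contra! hlt
      exact absurd this (not_le.mpr (div_pos hlt (hnpos t)))
  · by_contra! hzero
    have h1 := is_const_of_deriv_eq_zero (fun t => (hφ' t).differentiableAt)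
      (fun t => by rw [(hφ' t).deriv, hzero t, zero_div]) 0 1
    exact zero_ne_one (hinj h1)

/-! ### Monotonicity of the rotation number -/

/-- A continuous function with positive derivative wherever its value is not an integer is
monotone: a decrease would cross some non-integer level downwards. -/
theorem monotoneOn_of_deriv_pos_of_ne_int {f : ℝ → ℝ} (hf : Continuous f)
    (h : ∀ s, 0 < s → (∀ m : ℤ, f s ≠ m) → ∃ d, 0 < d ∧ HasDerivAt f d s) :
    MonotoneOn f (Ici 0) := by
  intro x hx y hy hxy
  by_contra! hlt
  obtain ⟨c, hc, hyc, hcx⟩ := exists_irrational_btwn hlt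
  obtain ⟨u, ⟨⟨hxu, huy⟩, hcu⟩, humax⟩ :=
    (isCompact_Icc.inter_right (isClosed_le continuous_const hf)).exists_isGreatest
      (s := Icc x y ∩ {t | c ≤ f t}) ⟨x, ⟨le_rfl, hxy⟩, hcx.le⟩
  have huy' : u < y := huy.lt_of_ne fun h => by
    rw [h] at hcu
    exact absurd hcu (not_le.mpr hyc)
  have hright : ∀ᶠ t in 𝓝[>] u, c ≤ f t := by
    rcases (show c ≤ f u from hcu).lt_or_eq with h1 | h1
    · have h2 := hf.continuousAt.eventually_const_lt h1
      exact (h2.filter_mono nhdsWithin_le_nhds).mono fun t ht => ht.le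
    · have hu0 : 0 < u := lt_of_le_of_ne (le_trans hx hxu) fun h0 => by
        have hxu' : x = u := le_antisymm hxu (h0 ▸ hx)
        rw [hxu', ← h1] at hcx
        exact lt_irrefl _ hcx
      obtain ⟨d, hd, hfd⟩ := h u hu0 fun m => h1 ▸ hc.ne_int m
      have hsl := ((hasDerivAt_iff_tendsto_slope.mp hfd).eventually_const_lt hd).filter_mono
        (nhdsWithin_mono u fun t (ht : u < t) => ht.ne')
      filter_upwards [hsl, self_mem_nhdsWithin] with t ht htu
      rw [slope_def_field] at ht
      have := (div_pos_iff_of_pos_right (sub_pos.mpr htu)).mp ht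
      linarith
  obtain ⟨t, hct, hut, hty⟩ := (hright.and (Ioo_mem_nhdsGT huy')).exists
  exact absurd (humax ⟨⟨hxu.trans hut.le, hty.le⟩, hct⟩) (not_le.mpr hut)

/-- The shape of the rotation number as a function of the inverse length: it climbs from zero to
the plateau at one without stopping. -/
theorem exists_plateau {r : ℝ → ℝ} (hr : Continuous r) (h0 : r 0 = 0) {s₁ : ℝ}
    (h1 : ∀ s, s₁ < s → r s = 1)
    (h : ∀ s, 0 < s → (∀ m : ℤ, r s ≠ m) → ∃ d, 0 < d ∧ HasDerivAt r d s)
    {ε : ℝ} (hε : 0 < ε) (hne : ∀ s, 0 < s → s < ε → r s ≠ 0) :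
    ∃ s₀, 0 < s₀ ∧ (∀ s, s₀ ≤ s → r s = 1) ∧ ∀ s, 0 < s → s < s₀ → 0 < r s ∧ r s < 1 := by
  have hmono := monotoneOn_of_deriv_pos_of_ne_int hr h
  have hle : ∀ s, 0 ≤ s → r s ≤ 1 := fun s hs => by
    have hs' : s ≤ max s (s₁ + 1) := le_max_left _ _
    rw [← h1 (max s (s₁ + 1)) ((lt_add_one s₁).trans_le (le_max_right _ _))]
    exact hmono hs (le_trans hs hs') hs'
  set S : Set ℝ := Ici 0 ∩ {s | r s = 1} with hS
  have hSc : IsClosed S := isClosed_Ici.inter (isClosed_eq hr continuous_const)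
  have hSb : BddBelow S := ⟨0, fun s hs => hs.1⟩
  have hSn : S.Nonempty := ⟨max 0 (s₁ + 1), mem_Ici.mpr (le_max_left _ _),
    h1 _ ((lt_add_one s₁).trans_le (le_max_right _ _))⟩
  obtain ⟨hm0, hm1⟩ := hSc.csInf_mem hSn hSb
  have hpos : 0 < sInf S := lt_of_le_of_ne hm0 fun h2 => by
    have h3 : r (sInf S) = 1 := hm1
    rw [← h2, h0] at h3
    exact zero_ne_one h3
  refine ⟨sInf S, hpos, fun s hs => ?_, fun s hs hlt => ⟨?_, ?_⟩⟩
  · refine le_antisymm (hle s (hpos.le.trans hs)) ?_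
    have := hmono hm0 (mem_Ici.mpr (hpos.le.trans hs)) hs
    rwa [hm1] at this
  · have h2 : 0 ≤ r s := h0 ▸ hmono (mem_Ici.mpr le_rfl) (mem_Ici.mpr hs.le) hs.le
    refine lt_of_le_of_ne h2 fun h3 => ?_
    have hmin : 0 < min s ε := lt_min hs hε
    have h4 : r (min s ε / 2) ≤ r s := hmono (mem_Ici.mpr (by positivity)) (mem_Ici.mpr hs.le)
      (by linarith [min_le_left s ε])
    have h5 : r 0 ≤ r (min s ε / 2) := hmono (mem_Ici.mpr le_rfl) (mem_Ici.mpr (by positivity))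
      (by positivity)
    exact hne (min s ε / 2) (by positivity) (by linarith [min_le_right s ε])
      (by linarith)
  · refine lt_of_le_of_ne (hle s hs.le) fun h2 => ?_
    exact absurd (csInf_le hSb ⟨mem_Ici.mpr hs.le, h2⟩) (not_le.mpr hlt)

/-! ### The rotation number, the elliptic set and the area in terms of the inverse length -/

theorem angleFlow_eq (Γ : ℝ → ℂ) (R θ₀ : ℝ) : angleFlow Γ R θ₀ = angle (deriv Γ) R⁻¹ θ₀ := by
  simp only [angleFlow, angle, isBicycleAngle_iff]

theorem rotationNumber_eq_turning (hV : IsPeriodicVelocity (deriv Γ) L) (R : ℝ) :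
    rotationNumber Γ L R = turning hV R⁻¹ := by
  rw [rotationNumber, angleFlow_eq]
  exact (hV.angle_spec R⁻¹ 0).1.tendsto_turning hV |>.limUnder_eq

theorem hasRotationNumber (hV : IsPeriodicVelocity (deriv Γ) L) (R : ℝ) :
    HasRotationNumber Γ L R (rotationNumber Γ L R) := by
  refine ⟨fun θ₀ => ⟨_, isBicycleAngle_iff.mpr (hV.angle_spec R⁻¹ θ₀).1,
    (hV.angle_spec R⁻¹ θ₀).2⟩, fun θ hθ => ?_⟩
  rw [rotationNumber_eq_turning hV]
  exact (isBicycleAngle_iff.mp hθ).tendsto_turning hV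

theorem mem_ellipticSet_iff (hV : IsPeriodicVelocity (deriv Γ) L) {R : ℝ} :
    R ∈ ellipticSet Γ L ↔ 0 < R ∧ ∀ m : ℤ, turning hV R⁻¹ ≠ m := by
  refine and_congr_right fun _ => ⟨fun h m hm => ?_, fun h z hz => ?_⟩
  · obtain ⟨θ, hθ, hL⟩ := (turning_eq_int_iff hV).mp hm
    refine h (Circle.exp (θ 0)) ?_
    obtain ⟨k, hk⟩ := Circle.exp_eq_exp.mp (Circle.exp_arg (Circle.exp (θ 0)))
    have h1 := (hθ.add_int_mul_two_pi k).angle_eq hV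
    rw [← hk] at h1
    rw [monodromy, angleFlow_eq, h1]
    dsimp only
    rw [hL]
    refine Circle.exp_eq_exp.mpr ⟨m + k, ?_⟩
    push_cast
    ring
  · rw [monodromy, angleFlow_eq] at hz
    obtain ⟨hA, hA0⟩ := hV.angle_spec R⁻¹ (Complex.arg z)
    nth_rewrite 2 [← Circle.exp_arg z] at hz
    obtain ⟨m, hm⟩ := Circle.exp_eq_exp.mp hz
    refine h m ((turning_eq_int_iff hV).mpr ⟨_, hA, ?_⟩)
    rw [hm, hA0]

/-- The algebraic area does not depend on the choice of the origin. -/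
theorem integral_det_sub_eq_area (hV : IsPeriodicVelocity (deriv Γ) L)
    (hΓ : ∀ t, HasDerivAt Γ (deriv Γ t) t) (hΓL : Γ L = Γ 0) (z : ℂ) :
    ∫ t in (0 : ℝ)..L, det (Γ t - z) (deriv Γ t) = 2 * area Γ L := by
  have hΓc : Continuous Γ := continuous_iff_continuousAt.mpr fun t => (hΓ t).continuousAt
  have hg := hV.continuous
  have hc : ∀ z : ℂ, Continuous fun t => det (Γ t - z) (deriv Γ t) := fun z => by
    unfold det
    fun_prop
  have key := intervalIntegral.integral_eq_sub_of_hasDerivAt (a := 0) (b := L)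
    (f := fun t => z.re * (Γ t).im - z.im * (Γ t).re)
    (f' := fun t => det (Γ t - 0) (deriv Γ t) - det (Γ t - z) (deriv Γ t)) (fun t _ => by
      refine (((Complex.imCLM.hasFDerivAt.comp_hasDerivAt t (hΓ t)).const_mul z.re).sub
        ((Complex.reCLM.hasFDerivAt.comp_hasDerivAt t (hΓ t)).const_mul z.im)).congr_deriv ?_
      simp [det]
      ring) (((hc 0).sub (hc z)).intervalIntegrable _ _)
  rw [hΓL, sub_self, intervalIntegral.integral_sub ((hc 0).intervalIntegrable _ _)
    ((hc z).intervalIntegrable _ _)] at key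
  simp only [sub_zero] at key
  rw [area]
  linarith

theorem rotationIndex_eq (Γ : ℝ → ℂ) (L : ℝ) : rotationIndex Γ L =
    (∫ t in (0 : ℝ)..L, (deriv (deriv Γ) t / deriv Γ t).im) / (2 * Real.pi) := by
  rw [rotationIndex, one_div_mul_eq_div]
  congr 1
  refine intervalIntegral.integral_congr fun t _ => ?_
  simp only [im_div_eq_det_div, curvature]
  rcases eq_or_ne (deriv Γ t) 0 with h | h
  · simp [h]
  · have := norm_ne_zero_iff.mpr h
    field_simp

/-- For a star-shaped curve the areal velocity about the centre is nonnegative if the rotation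
index is one: otherwise the rotation number, which is one for short bicycles, would decrease in
the inverse length, starting from zero. -/
theorem exists_center_of_isStarShaped (hV : IsPeriodicVelocity g L)
    (hΓ : ∀ t, HasDerivAt Γ (g t) t) (hΓp : Function.Periodic Γ L) (h0 : ∀ t, g t ≠ 0)
    (hstar : IsStarShaped (range Γ)) {s₁ : ℝ} (h1 : ∀ s, s₁ < s → turning hV s = 1) :
    ∃ z₀ : ℂ, (∀ t, 0 ≤ det (Γ t - z₀) (g t)) ∧
      0 < ∫ t in (0 : ℝ)..L, det (Γ t - z₀) (g t) := by
  obtain ⟨z₀, hsign, t₀, ht₀⟩ := det_sign_of_isStarShaped hΓ hV.continuous h0 hstar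
  have hΓc : Continuous Γ := continuous_iff_continuousAt.mpr fun t => (hΓ t).continuousAt
  have hg := hV.continuous
  have hDc : Continuous fun t => det (Γ t - z₀) (g t) := by
    unfold det
    fun_prop
  have hDp : Function.Periodic (fun t => det (Γ t - z₀) (g t)) L := fun t => by
    simp only [hΓp t, hV.periodic t]
  obtain ⟨c, hc, hct⟩ := hDp.exists_mem_Ico₀ hV.pos t₀
  have hc' := Ico_subset_Icc_self hc
  simp only [hct] at ht₀
  refine ⟨z₀, ?_⟩
  rcases hsign with hs | hs
  · exact ⟨hs, intervalIntegral.integral_pos hV.pos hDc.continuousOn (fun t _ => hs t)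
      ⟨c, hc', lt_of_le_of_ne (hs c) ht₀.symm⟩⟩
  · exfalso
    have hmono : MonotoneOn (fun s => -turning hV s) (Ici 0) := by
      refine monotoneOn_of_deriv_pos_of_ne_int (continuous_turning hV).neg fun s hspos hne => ?_
      obtain ⟨w, hwc, hw1, hd⟩ := exists_hasDerivAt_turning hV
        (Γ := fun t => Γ t - z₀) (fun t => (hΓ t).sub_const z₀) (by simp only [hΓp.eq])
        (s := s) fun m hm => hne (-m) (by rw [hm]; push_cast; rfl)
      refine ⟨_, ?_, hd.neg⟩
      have hpos : 0 < ∫ t in (0 : ℝ)..L, -(w t * det (Γ t - z₀) (g t)) := by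
        refine intervalIntegral.integral_pos hV.pos (hwc.mul hDc).neg.continuousOn
          (fun t _ => ?_) ⟨c, hc', ?_⟩
        · nlinarith [hw1 t, hs t]
        · nlinarith [hw1 c, lt_of_le_of_ne (hs c) ht₀]
      rw [intervalIntegral.integral_neg] at hpos
      have := Real.pi_pos
      rw [← mul_neg]
      positivity
    have h2 := hmono (mem_Ici.mpr le_rfl)
      (mem_Ici.mpr ((zero_le_one.trans (le_add_of_nonneg_left (abs_nonneg s₁)))))
      (zero_le_one.trans (le_add_of_nonneg_left (abs_nonneg s₁)))
    simp only [turning_zero, h1 (|s₁| + 1) (by linarith [le_abs_self s₁])] at h2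
    norm_num at h2

end Bicycle

theorem theorem4 (Γ : ℝ → ℂ) (L : ℝ) (hL : 0 < L)
    (hC2 : ContDiff ℝ 2 Γ) (hper : Function.Periodic Γ L) (hreg : ∀ t : ℝ, deriv Γ t ≠ 0)
    (hstar : Bicycle.IsStarShaped (Set.range Γ)) (hω : Bicycle.rotationIndex Γ L = 1) :
    -- the rotation number function and the two lengths are well defined
    (∀ R : ℝ, 0 < R → Bicycle.HasRotationNumber Γ L R (Bicycle.rotationNumber Γ L R)) ∧
    IsLUB (Bicycle.plateauSet Γ L) (Bicycle.criticalLength Γ L) ∧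
    IsGLB (Bicycle.turningSet Γ L) (Bicycle.turningLength Γ L) ∧
    0 < Bicycle.criticalLength Γ L ∧
    -- the elliptic set has exactly one connected component, which is the given half-line
    IsConnected (Bicycle.ellipticSet Γ L) ∧
    Bicycle.ellipticSet Γ L = Set.Ioi (Bicycle.criticalLength Γ L) ∧
    -- the rate of decrease
    (∀ R : ℝ, Bicycle.criticalLength Γ L < R →
      DifferentiableAt ℝ (Bicycle.rotationNumber Γ L) R ∧
      deriv (Bicycle.rotationNumber Γ L) R ≤ -(Bicycle.area Γ L) / (Real.pi * R ^ 3)) ∧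
    -- the two lengths coincide
    Bicycle.criticalLength Γ L = Bicycle.turningLength Γ L := by
  open Bicycle in
  have hC1 : ContDiff ℝ 1 (deriv Γ) := by
    have : ContDiff ℝ (1 + 1) Γ := by simpa [one_add_one_eq_two] using hC2
    exact (contDiff_succ_iff_deriv.mp this).2.2
  have hΓ : ∀ t, HasDerivAt Γ (deriv Γ t) t := fun t =>
    (hC2.differentiable (by norm_num) t).hasDerivAt
  have hg : ∀ t, HasDerivAt (deriv Γ) (deriv (deriv Γ) t) t := fun t =>
    (hC1.differentiable (by norm_num) t).hasDerivAt
  have periodic_deriv : ∀ f : ℝ → ℂ, Function.Periodic f L → Function.Periodic (deriv f) L :=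
    fun f hf t => by rw [← deriv_comp_add_const, funext hf]
  have hV : IsPeriodicVelocity (deriv Γ) L := ⟨hC1.continuous, periodic_deriv Γ hper, hL⟩
  obtain ⟨s₁, h1⟩ := exists_turning_eq_of_lt hV hg (hC1.continuous_deriv le_rfl)
    (periodic_deriv _ hV.periodic) hreg
  rw [← rotationIndex_eq, hω] at h1
  obtain ⟨z₀, hD, hint⟩ := exists_center_of_isStarShaped hV hΓ hper hreg hstar h1
  have hΓc : Continuous Γ := hC2.continuous
  have hgc := hV.continuous
  have hDc : Continuous fun t => det (Γ t - z₀) (deriv Γ t) := by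
    unfold det
    fun_prop
  have hA := integral_det_sub_eq_area hV hΓ hper.eq z₀
  have hApos : 0 < area Γ L := by linarith
  have hderiv : ∀ s, 0 < s → (∀ m : ℤ, turning hV s ≠ m) →
      ∃ d, s * area Γ L / Real.pi ≤ d ∧ HasDerivAt (turning hV) d s := by
    intro s hs hne
    obtain ⟨w, hwc, hw1, hd⟩ := exists_hasDerivAt_turning hV
      (Γ := fun t => Γ t - z₀) (fun t => (hΓ t).sub_const z₀) (by simp only [hper.eq]) hne
    refine ⟨_, ?_, hd⟩
    have hle : ∫ t in (0 : ℝ)..L, det (Γ t - z₀) (deriv Γ t) ≤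
        ∫ t in (0 : ℝ)..L, w t * det (Γ t - z₀) (deriv Γ t) :=
      intervalIntegral.integral_mono hL.le (hDc.intervalIntegrable _ _)
        ((hwc.mul hDc).intervalIntegrable _ _)
        fun t => le_mul_of_one_le_left (hD t) (hw1 t)
    rw [hA] at hle
    have hpi := Real.pi_pos
    calc s * area Γ L / Real.pi = s / (2 * Real.pi) * (2 * area Γ L) := by field_simp
      _ ≤ _ := by gcongr
  obtain ⟨C, hC⟩ := exists_abs_integral_det_le hV
    (Γ := fun t => Γ t - z₀) (fun t => (hΓ t).sub_const z₀) (by simp only [hper.eq])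
  have hCpos : 0 < |C| + 1 := by positivity
  obtain ⟨s₀, hs₀, hplateau, hclimb⟩ := exists_plateau (continuous_turning hV) (turning_zero hV) h1
    (fun s hs hne =>
      let ⟨d, hd, hd'⟩ := hderiv s hs hne
      ⟨d, lt_of_lt_of_le (div_pos (mul_pos hs hApos) Real.pi_pos) hd, hd'⟩)
    -- a vanishing rotation number would give `2 A ≤ C s`
    (ε := 2 * area Γ L / (|C| + 1)) (by positivity) (fun s hs hlt h => by
      obtain ⟨θ, hθ, hθL⟩ := (turning_eq_int_iff hV (m := 0)).mp (by simpa using h)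
      have := hC s hs θ hθ (by simpa using hθL)
      rw [hA, abs_of_pos (by positivity)] at this
      rw [lt_div_iff₀ hCpos] at hlt
      nlinarith [le_abs_self C])
  have hρ : rotationNumber Γ L = fun R => turning hV R⁻¹ :=
    funext (rotationNumber_eq_turning hV)
  have hpl : plateauSet Γ L = Ioc 0 s₀⁻¹ := by
    ext R'
    simp only [plateauSet, mem_ofPred_eq, mem_Ioc, hω, hρ]
    refine and_congr_right fun hR' => ⟨fun h => ?_, fun h R hR hRR' => ?_⟩
    · by_contra! hlt
      exact ((hclimb R'⁻¹ (inv_pos.mpr hR') (inv_lt_of_inv_lt₀ hs₀ hlt)).2).ne (h R' hR' le_rfl)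
    · exact hplateau _ ((le_inv_comm₀ hR hs₀).mp (hRR'.trans h))
  have hs₀' : 0 < s₀⁻¹ := inv_pos.mpr hs₀
  have hcrit : criticalLength Γ L = s₀⁻¹ := by
    rw [criticalLength, hpl, csSup_Ioc hs₀']
  have hlong : ∀ R, s₀⁻¹ < R → 0 < R ∧ 0 < turning hV R⁻¹ ∧ turning hV R⁻¹ < 1 := by
    intro R hR
    have hR0 := hs₀'.trans hR
    exact ⟨hR0, hclimb _ (inv_pos.mpr hR0) (inv_lt_of_inv_lt₀ hs₀ hR)⟩
  have hnotint : ∀ R, s₀⁻¹ < R → ∀ m : ℤ, turning hV R⁻¹ ≠ m := by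
    intro R hR m hm
    obtain ⟨-, h2, h3⟩ := hlong R hR
    rw [hm] at h2 h3
    have h4 : 0 < m := by exact_mod_cast h2
    have h5 : m < 1 := by exact_mod_cast h3
    omega
  have hell : ellipticSet Γ L = Ioi s₀⁻¹ := by
    ext R
    rw [mem_ellipticSet_iff hV, mem_Ioi]
    refine ⟨fun ⟨hR, h⟩ => ?_, fun hR => ⟨(hlong R hR).1, hnotint R hR⟩⟩
    by_contra! hle
    refine h 1 ?_
    rw [hplateau _ ((le_inv_comm₀ hR hs₀).mp hle), Int.cast_one]
  have hρ' : ∀ R, s₀⁻¹ < R → ∃ d, d ≤ -(area Γ L) / (Real.pi * R ^ 3) ∧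
      HasDerivAt (rotationNumber Γ L) d R := by
    intro R hR
    have hR0 := (hlong R hR).1
    obtain ⟨d, hd, hd'⟩ := hderiv R⁻¹ (inv_pos.mpr hR0) (hnotint R hR)
    rw [hρ]
    refine ⟨_, ?_, hd'.comp R (hasDerivAt_inv hR0.ne')⟩
    have hpi := Real.pi_pos
    calc d * -(R ^ 2)⁻¹ = -(d * (R ^ 2)⁻¹) := by ring
      _ ≤ -(R⁻¹ * area Γ L / Real.pi * (R ^ 2)⁻¹) := by gcongr
      _ = _ := by field_simp
  have hanti : StrictAntiOn (rotationNumber Γ L) (Ioi s₀⁻¹) := by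
    refine strictAntiOn_of_deriv_neg (convex_Ioi _) (fun R hR => ?_) fun R hR => ?_
    · obtain ⟨d, -, hd⟩ := hρ' R hR
      exact hd.continuousAt.continuousWithinAt
    · rw [interior_Ioi] at hR
      obtain ⟨d, hle, hd⟩ := hρ' R hR
      have hR0 := (hlong R hR).1
      rw [hd.deriv]
      exact hle.trans_lt (div_neg_of_neg_of_pos (neg_neg_of_pos hApos)
        (mul_pos Real.pi_pos (pow_pos hR0 3)))
  have hleast : IsLeast (turningSet Γ L) s₀⁻¹ := by
    refine ⟨⟨hcrit.le, fun R hR => ?_, Or.inr hanti⟩, fun R' hR' => hcrit ▸ hR'.1⟩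
    rw [hω, hρ]
    exact (hlong R hR).2.2.ne
  have hturn : turningLength Γ L = s₀⁻¹ := hleast.csInf_eq
  rw [hcrit, hturn, hpl, hell]
  exact ⟨fun R _ => hasRotationNumber hV R, isLUB_Ioc hs₀', hleast.isGLB, hs₀', isConnected_Ioi,
    rfl, fun R hR => let ⟨_, hle, hd⟩ := hρ' R hR
    ⟨hd.differentiableAt, hd.deriv ▸ hle⟩, rfl⟩
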